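/- Let $r\ge 1$. Let $\mathfrak h\subset\mathfrak{sl}_{r+1}(\mathbb C)$ be the Cartan subalgebra of diagonal matrices, let $\alpha_1,\dots,\alpha_r\in\mathfrak h^*$, $\alpha_k(H)=H_{k,k}-H_{k+1,k+1}$, be the simple roots, let $\Phi^+=\{\alpha_i+\alpha_{i+1}+\cdots+\alpha_j : 1\le i\le j\le r\}$ be the set of positive roots, $\tilde\alpha=\alpha_1+\cdots+\alpha_r$ the highest root, and $\rho=\frac12\sum_{\alpha\in\Phi^+}\alpha$. Let $W$ be the Weyl group, that is, the group of linear transformations of $\mathfrak h^*$ generated by the simple reflections $s_k(\lambda)=\lambda-\lambda(E_{k,k}-E_{k+1,k+1})\,\alpha_k$ for $1\le k\le r$, and for $\sigma\in W$ let $\ell(\sigma)$ be the least number of simple reflections whose product is $\sigma$. For $\xi\in\mathfrak h^*$ let $\wp_q(\xi)=c_0+c_1q+c_2q^2+\cdots\in\mathbb Z[q]$ (a finite sum), where $c_n$ is the number of ways to write $\xi$ as an unordered sum of exactly $n$ positive roots, repetitions allowed. For $\lambda,\mu\in\mathfrak h^*$ put $$m_q(\lambda,\mu)=\sum_{\sigma\in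 W}(-1)^{\ell(\sigma)}\,\wp_q\bigl(\sigma(\lambda+\rho)-\rho-\mu\bigr)\in\mathbb Z[q].$$ Theorem. Let $1\le i\le j\le r$ and $\mu=\alpha_i+\alpha_{i+1}+\cdots+\alpha_j\in\Phi^+$. Then, as polynomials in $q$, $$m_q(\tilde\alpha,\mu)=q^{\,r-h(\mu)},$$ where $h(\mu)=j-i+1$ is the height of $\mu$. Moreover, the value of $m_q(\tilde\alpha,\mu)$ at $q=1$ equals the multiplicity of the weight $\mu$ in the adjoint representation of $\mathfrak{sl}_{r+1}(\mathbb C)$, that is, the dimension of $\{X\in\mathfrak{sl}_{r+1}(\mathbb C) : [H,X]=\mu(H)X\ \text{for all } H\in\mathfrak h\}$, and this multiplicity is $1$. -/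

import Mathlib

attribute [local instance] LieRing.ofAssociativeRing

namespace TypeA

open Finset Module

noncomputable section

/-- The Lie algebra `𝔰𝔩_{r+1}(ℂ)` of traceless matrices, with rows and columns indexed by
`0, …, r`. -/
abbrev SL (r : ℕ) : Type := LieAlgebra.SpecialLinear.sl (Fin (r + 1)) ℂ

/-- The Cartan subalgebra `𝔥` of diagonal traceless matrices. -/
def cartan (r : ℕ) : LieSubalgebra ℂ (SL r) where
  carrier := {A | A.1.IsDiag}
  zero_mem' := Matrix.isDiag_zero
  add_mem' ha hb := Matrix.IsDiag.add ha hb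
  smul_mem' c _ ha := Matrix.IsDiag.smul c ha
  lie_mem' {A B} ha hb := by
    have h : (⁅A, B⁆ : SL r).1 = 0 := by
      rw [LieAlgebra.SpecialLinear.sl_bracket, ← Matrix.IsDiag.diagonal_diag ha,
        ← Matrix.IsDiag.diagonal_diag hb, Matrix.diagonal_mul_diagonal,
        Matrix.diagonal_mul_diagonal, sub_eq_zero]
      congr 1
      ext i
      exact mul_comm _ _
    change (⁅A, B⁆ : SL r).1.IsDiag
    rw [h]
    exact Matrix.isDiag_zero

/-- The space `𝔥*` of weights (linear functionals on the Cartan subalgebra). -/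
abbrev Weight (r : ℕ) : Type := Dual ℂ (cartan r)

/-- The `k`-th diagonal entry, as a linear functional on `𝔥`. -/
def diagEntry (r : ℕ) (k : Fin (r + 1)) : Weight r where
  toFun H := H.1.1 k k
  map_add' _ _ := rfl
  map_smul' _ _ := rfl

@[simp] lemma diagEntry_apply (r : ℕ) (k : Fin (r + 1)) (H : cartan r) :
    diagEntry r k H = H.1.1 k k := rfl

/-- The simple roots `H ↦ H_{k,k} - H_{k+1,k+1}`; `Fin r` is `{0, …, r - 1}`, so that
`simpleRoot r k` is the root usually written `α_{k+1}`. -/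
def simpleRoot (r : ℕ) (k : Fin r) : Weight r :=
  diagEntry r k.castSucc - diagEntry r k.succ

/-- The sum `α_i + α_{i+1} + ⋯ + α_j` of consecutive simple roots. -/
def rootSum (r : ℕ) (i j : Fin r) : Weight r := ∑ k ∈ Icc i j, simpleRoot r k

open scoped Classical in
/-- The set `Φ⁺` of positive roots: all `α_i + ⋯ + α_j` with `i ≤ j`
(see `mem_positiveRoots_iff`). -/
def positiveRoots (r : ℕ) : Finset (Weight r) :=
  (univ.filter fun p : Fin r × Fin r => p.1 ≤ p.2).image fun p => rootSum r p.1 p.2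

/-- The highest root `α_1 + ⋯ + α_r` (see `highestRoot_mem` and `highestRoot_sub`). -/
def highestRoot (r : ℕ) : Weight r := ∑ k : Fin r, simpleRoot r k

/-- Half the sum of the positive roots. -/
def rho (r : ℕ) : Weight r := (1 / 2 : ℂ) • ∑ α ∈ positiveRoots r, α

/-- The weight space of weight `μ` in the adjoint representation of `𝔰𝔩_{r+1}(ℂ)`: all `X` with
`[H, X] = μ(H) X` for every `H` in the Cartan subalgebra. -/
def adjointWeightSpace (r : ℕ) (μ : Weight r) : LieSubmodule ℂ (cartan r) (SL r) :=
  LieModule.weightSpace (SL r) (fun H : cartan r => μ H)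

/-- The simple coroot `E_{k,k} - E_{k+1,k+1}`. -/
def simpleCoroot (r : ℕ) (k : Fin r) : cartan r :=
  ⟨LieAlgebra.SpecialLinear.singleSubSingle k.castSucc k.succ (1 : ℂ), by
    intro a b hab
    rw [LieAlgebra.SpecialLinear.val_singleSubSingle, Matrix.sub_apply,
      Matrix.single_apply_of_ne _ _ _ _ _ (fun h => hab (h.1.symm.trans h.2)),
      Matrix.single_apply_of_ne _ _ _ _ _ (fun h => hab (h.1.symm.trans h.2)), sub_zero]⟩

lemma simpleCoroot_entry (r : ℕ) (k : Fin r) (a : Fin (r + 1)) :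
    (simpleCoroot r k).1.1 a a =
      (if k.castSucc = a then 1 else 0) - (if k.succ = a then 1 else 0) := by
  simp [simpleCoroot, LieAlgebra.SpecialLinear.val_singleSubSingle, Matrix.single_apply]

lemma simpleRoot_simpleCoroot (r : ℕ) (k : Fin r) :
    Dual.eval ℂ (cartan r) (simpleCoroot r k) (simpleRoot r k) = 2 := by
  have h : k.castSucc ≠ k.succ := k.castSucc_lt_succ.ne
  simp [simpleRoot, simpleCoroot_entry, h, h.symm]
  norm_num

/-- The simple reflection `λ ↦ λ - λ(H_k) α_k` of `𝔥*`, where `H_k` is the coroot of `α_k`. -/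
def simpleReflection (r : ℕ) (k : Fin r) : Weight r ≃ₗ[ℂ] Weight r :=
  Module.reflection (simpleRoot_simpleCoroot r k)

/-- The Weyl group, acting on `𝔥*`: it is generated by the simple reflections. -/
def weylGroup (r : ℕ) : Subgroup (Weight r ≃ₗ[ℂ] Weight r) :=
  Subgroup.closure (Set.range (simpleReflection r))

/-- The length of `σ`: the least number of simple reflections with product `σ`. -/
def length (r : ℕ) (σ : weylGroup r) : ℕ :=
  sInf {k | ∃ w : List (Fin r), w.length = k ∧ (w.map (simpleReflection r)).prod = σ}

lemma exists_word (r : ℕ) (σ : weylGroup r) :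
    ∃ w : List (Fin r), w.length = length r σ ∧ (w.map (simpleReflection r)).prod = σ := by
  have h : ∃ w : List (Fin r), (w.map (simpleReflection r)).prod = σ.1 := by
    obtain ⟨σ, hσ⟩ := σ
    induction hσ using Subgroup.closure_induction with
    | mem σ h =>
      obtain ⟨k, rfl⟩ := h
      exact ⟨[k], by simp⟩
    | one => exact ⟨[], rfl⟩
    | mul σ τ _ _ h₁ h₂ =>
      obtain ⟨v, hv⟩ := h₁
      obtain ⟨w, hw⟩ := h₂
      refine ⟨v ++ w, ?_⟩
      change _ = σ * τ
      rw [List.map_append, List.prod_append, hv, hw]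
    | inv σ _ h =>
      obtain ⟨w, hw⟩ := h
      refine ⟨w.reverse, ?_⟩
      change _ = σ⁻¹
      have hw : (w.map (simpleReflection r)).prod = σ := hw
      rw [← hw, List.prod_inv_reverse, List.map_reverse, List.map_map]
      rfl
  obtain ⟨w, hw⟩ := h
  exact Nat.sInf_mem (s := {k | ∃ w : List (Fin r), w.length = k ∧
    (w.map (simpleReflection r)).prod = σ}) ⟨w.length, w, rfl, hw⟩

/-- The number of ways to write `ξ` as a sum of exactly `n` positive roots, that is, the number of
multisets of `n` positive roots with sum `ξ`. -/
def partitionCount (r : ℕ) (ξ : Weight r) (n : ℕ) : ℕ :=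
  Nat.card {m : Multiset (Weight r) // (∀ α ∈ m, α ∈ positiveRoots r) ∧ m.card = n ∧ m.sum = ξ}

lemma finite_partitions (r : ℕ) (ξ : Weight r) (n : ℕ) :
    Finite {m : Multiset (Weight r) //
      (∀ α ∈ m, α ∈ positiveRoots r) ∧ m.card = n ∧ m.sum = ξ} := by
  classical
  apply Finite.of_injective (β := {s : Sym (Weight r) n // s ∈ (positiveRoots r).sym n})
    fun m => ⟨⟨m.1, m.2.2.1⟩, Finset.mem_sym_iff.2 fun α hα => m.2.1 α hα⟩
  intro m m' h
  exact Subtype.ext (congrArg (fun s => (s.1 : Multiset (Weight r))) h)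

/-- The `q`-analog `℘_q(ξ) = c_0 + c_1 q + c_2 q² + ⋯` of Kostant's partition function, where `c_n`
is the number of ways to write `ξ` as a sum of exactly `n` positive roots. The sum is finite, see
`coeff_qPartition`. -/
def qPartition (r : ℕ) (ξ : Weight r) : Polynomial ℤ :=
  ∑ᶠ n : ℕ, Polynomial.monomial n (partitionCount r ξ n : ℤ)

lemma rootSum_eq (r : ℕ) (i j : Fin r) (h : i ≤ j) :
    rootSum r i j = diagEntry r i.castSucc - diagEntry r j.succ := by
  obtain ⟨j, hj⟩ := j
  induction j with
  | zero =>
    have : i = ⟨0, hj⟩ := le_antisymm h (Nat.zero_le _)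
    subst this
    simp [rootSum, simpleRoot]
  | succ j ih =>
    rcases eq_or_lt_of_le h with rfl | h'
    · simp [rootSum, simpleRoot]
    · have hj' : j < r := by omega
      have hle : i ≤ ⟨j, hj'⟩ := Nat.le_of_lt_succ h'
      have hI : Icc i ⟨j + 1, hj⟩ = insert ⟨j + 1, hj⟩ (Icc i ⟨j, hj'⟩) := by
        ext x
        simp only [mem_Icc, mem_insert, Fin.ext_iff, Fin.le_def] at hle h ⊢
        omega
      have := ih hj' hle
      rw [rootSum] at this ⊢
      rw [hI, sum_insert (by simp [Fin.le_def]), this, simpleRoot]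
      have e : (⟨j + 1, hj⟩ : Fin r).castSucc = (⟨j, hj'⟩ : Fin r).succ := rfl
      rw [e]
      abel

lemma rootSum_mem (r : ℕ) {i j : Fin r} (h : i ≤ j) : rootSum r i j ∈ positiveRoots r := by
  classical
  exact mem_image.2 ⟨(i, j), by simpa using h, rfl⟩

/-- The positive roots are exactly the nonzero weights of the adjoint representation that have a
nonzero weight vector in the Borel subalgebra of upper triangular matrices. -/
theorem mem_positiveRoots_iff (r : ℕ) (α : Weight r) :
    α ∈ positiveRoots r ↔
      α ≠ 0 ∧ ∃ X ∈ adjointWeightSpace r α, X ≠ 0 ∧ X.1.BlockTriangular id := by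
  classical
  have entry : ∀ (H : cartan r) (X : SL r) (a b : Fin (r + 1)),
      (⁅H, X⁆ : SL r).1 a b = (H.1.1 a a - H.1.1 b b) * X.1 a b := by
    intro H X a b
    have hd : H.1.1 = Matrix.diagonal H.1.1.diag := (Matrix.IsDiag.diagonal_diag H.2).symm
    have e : (⁅H, X⁆ : SL r).1 = H.1.1 * X.1 - X.1 * H.1.1 := rfl
    rw [e, hd, Matrix.sub_apply, Matrix.diagonal_mul, Matrix.mul_diagonal]
    simp only [Matrix.diag_apply, Matrix.diagonal_apply_eq]
    ring
  have smul_entry : ∀ (c : ℂ) (X : SL r) (a b : Fin (r + 1)), (c • X).1 a b = c * X.1 a b :=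
    fun _ _ _ _ => rfl
  constructor
  · intro h
    obtain ⟨⟨i, j⟩, hij, rfl⟩ := mem_image.1 h
    have hij : i ≤ j := by simpa using hij
    have hlt : i.castSucc < j.succ := Fin.castSucc_lt_succ_iff.2 hij
    have hne : i.castSucc ≠ j.succ := hlt.ne
    refine ⟨fun h0 => ?_, LieAlgebra.SpecialLinear.single _ _ hne (1 : ℂ), ?_, fun h0 => ?_, ?_⟩
    · have h1 := congrArg (fun f : Weight r => f (simpleCoroot r i)) h0
      have h2 : i.succ ≠ i.castSucc := i.castSucc_lt_succ.ne'
      simp only [rootSum_eq r i j hij, LinearMap.sub_apply, diagEntry_apply, simpleCoroot_entry,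
        hne, if_true, if_false, h2, LinearMap.zero_apply] at h1
      split_ifs at h1 <;> norm_num at h1
    · rw [adjointWeightSpace, LieModule.mem_weightSpace]
      intro H
      ext a b
      rw [entry, smul_entry]
      simp only [rootSum_eq r i j hij, LinearMap.sub_apply, diagEntry_apply,
        LieAlgebra.SpecialLinear.val_single, Matrix.single_apply]
      split_ifs with hab
      · rw [← hab.1, ← hab.2]
      · simp
    · have h1 := congrArg (fun X : SL r => X.1 i.castSucc j.succ) h0
      simp at h1
    · intro a b hab
      simp only [id] at hab
      rw [LieAlgebra.SpecialLinear.val_single]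
      apply Matrix.single_apply_of_ne
      rintro ⟨rfl, rfl⟩
      exact absurd hab hlt.not_gt
  · rintro ⟨hα, X, hX, hX0, hup⟩
    rw [adjointWeightSpace, LieModule.mem_weightSpace] at hX
    obtain ⟨a, b, hab⟩ : ∃ a b, X.1 a b ≠ 0 := by
      by_contra! h
      exact hX0 (Subtype.ext (Matrix.ext h))
    have hα' : α = diagEntry r a - diagEntry r b := by
      ext H
      have h1 := congrArg (fun X : SL r => X.1 a b) (hX H)
      simp only [entry, smul_entry] at h1
      exact (mul_right_cancel₀ hab h1).symm
    have hle : a ≤ b := by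
      by_contra! h
      exact hab (hup h)
    have hne : a ≠ b := by
      rintro rfl
      exact hα (by rw [hα', sub_self])
    have hlt : a.1 < b.1 := lt_of_le_of_ne hle (fun h => hne (Fin.ext h))
    have ha : a = Fin.castSucc (⟨a.1, by omega⟩ : Fin r) := rfl
    have hb : b = Fin.succ (⟨b.1 - 1, by omega⟩ : Fin r) := by
      apply Fin.ext
      simp only [Fin.succ_mk]
      omega
    have hle' : (⟨a.1, by omega⟩ : Fin r) ≤ ⟨b.1 - 1, by omega⟩ := by
      simp only [Fin.mk_le_mk]
      omega
    have e := rootSum_mem r hle'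
    rw [rootSum_eq r _ _ hle', ← ha, ← hb] at e
    rwa [hα']

lemma highestRoot_mem (r : ℕ) (hr : 1 ≤ r) : highestRoot r ∈ positiveRoots r := by
  have : highestRoot r = rootSum r ⟨0, hr⟩ ⟨r - 1, by omega⟩ := by
    rw [highestRoot, rootSum]
    congr 1
    ext x
    simp [Fin.le_def]
    omega
  rw [this]
  exact rootSum_mem r (Nat.zero_le _)

/-- The highest root exceeds every positive root by a sum of simple roots. -/
lemma highestRoot_sub (r : ℕ) (α : Weight r) (hα : α ∈ positiveRoots r) :
    ∃ s : Finset (Fin r), highestRoot r - α = ∑ k ∈ s, simpleRoot r k := by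
  classical
  obtain ⟨⟨i, j⟩, -, rfl⟩ := mem_image.1 hα
  refine ⟨(Icc i j)ᶜ, ?_⟩
  rw [sub_eq_iff_eq_add, highestRoot, rootSum, sum_compl_add_sum]

/-- The diagonal matrix with entries `r/2, r/2 - 1, …, -r/2`. -/
def rhoCheck (r : ℕ) : cartan r :=
  ⟨⟨Matrix.diagonal fun k : Fin (r + 1) => (r / 2 - k : ℂ), by
      change Matrix.trace (Matrix.diagonal fun k : Fin (r + 1) => (r / 2 - k : ℂ)) = 0
      have h : (∑ k : Fin (r + 1), ((k : ℕ) : ℂ)) * 2 = (r + 1) * r := by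
        rw [Fin.sum_univ_eq_sum_range (fun k => (k : ℂ))]
        have h1 := Finset.sum_range_id_mul_two (r + 1)
        rw [Nat.add_sub_cancel] at h1
        have h2 := congrArg (Nat.cast : ℕ → ℂ) h1
        push_cast at h2
        exact h2
      rw [Matrix.trace_diagonal, sum_sub_distrib]
      simp only [sum_const, card_univ, Fintype.card_fin, nsmul_eq_mul]
      push_cast
      linear_combination (-1 / 2 : ℂ) * h⟩,
    Matrix.isDiag_diagonal _⟩

lemma card_le_of_sum_eq (r : ℕ) (m : Multiset (Weight r)) (hm : ∀ α ∈ m, α ∈ positiveRoots r) :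
    (m.card : ℝ) ≤ (m.sum (rhoCheck r)).re := by
  classical
  induction m using Multiset.induction with
  | empty => simp
  | cons α m ih =>
    have h1 := ih fun β hβ => hm β (Multiset.mem_cons_of_mem hβ)
    have h2 : (1 : ℝ) ≤ (α (rhoCheck r)).re := by
      obtain ⟨⟨i, j⟩, hij, rfl⟩ := mem_image.1 (hm α (Multiset.mem_cons_self _ _))
      have hij : i ≤ j := by simpa using hij
      have hij' : (i : ℝ) ≤ j := by exact_mod_cast hij
      simp only [rootSum_eq r i j hij, LinearMap.sub_apply, diagEntry_apply, rhoCheck,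
        Matrix.diagonal_apply_eq]
      simp
      linarith
    rw [Multiset.card_cons, Multiset.sum_cons, LinearMap.add_apply, Complex.add_re]
    push_cast
    linarith

/-- The coefficients of `℘_q(ξ)` are the numbers `c_n`. -/
lemma coeff_qPartition (r : ℕ) (ξ : Weight r) (n : ℕ) :
    (qPartition r ξ).coeff n = partitionCount r ξ n := by
  have hfin : (Function.support fun n : ℕ =>
      Polynomial.monomial n (partitionCount r ξ n : ℤ)).Finite := by
    apply (Set.finite_Iic ⌊(ξ (rhoCheck r)).re⌋₊).subset
    intro n hn
    have h0 : partitionCount r ξ n ≠ 0 := fun h => hn (by simp [h])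
    obtain ⟨m, hm, rfl, rfl⟩ := (Nat.card_ne_zero.1 h0).1
    exact Nat.le_floor (card_le_of_sum_eq r m hm)
  rw [qPartition, finsum_eq_sum _ hfin, Polynomial.finsetSum_coeff]
  simp only [Polynomial.coeff_monomial, sum_ite_eq', Set.Finite.mem_toFinset,
    Function.mem_support]
  split_ifs with h
  · rfl
  · by_contra h'
    exact h fun h0 => h' (Polynomial.monomial_eq_zero_iff _ n |>.1 h0).symm

/-- Simultaneous permutation of rows and columns, on the Cartan subalgebra. -/
def permute (r : ℕ) (σ : Equiv.Perm (Fin (r + 1))) (H : cartan r) : cartan r :=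
  ⟨⟨H.1.1.submatrix σ σ, by
      change Matrix.trace (H.1.1.submatrix σ σ) = 0
      have h : Matrix.trace H.1.1 = 0 := H.1.2
      rw [← h]
      exact Equiv.sum_comp σ fun k => H.1.1 k k⟩,
    fun _ _ hab => H.2 fun h => hab (σ.injective h)⟩

lemma cartan_ext {r : ℕ} {H K : cartan r} (h : ∀ a, H.1.1 a a = K.1.1 a a) : H = K := by
  apply Subtype.ext
  apply Subtype.ext
  ext a b
  by_cases hab : a = b
  · rw [hab, h]
  · exact (H.2 hab).trans (K.2 hab).symm

lemma exists_perm (r : ℕ) (w : Weight r ≃ₗ[ℂ] Weight r) (hw : w ∈ weylGroup r) :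
    ∃ σ : Equiv.Perm (Fin (r + 1)), ∀ l H, w l H = l (permute r σ H) := by
  induction hw using Subgroup.closure_induction with
  | mem w hw =>
    obtain ⟨k, rfl⟩ := hw
    refine ⟨Equiv.swap k.castSucc k.succ, fun l H => ?_⟩
    have hne : k.castSucc ≠ k.succ := k.castSucc_lt_succ.ne
    have key : permute r (Equiv.swap k.castSucc k.succ) H =
        H - (simpleRoot r k H) • simpleCoroot r k := by
      apply cartan_ext
      intro a
      have e : (H - (simpleRoot r k H) • simpleCoroot r k).1.1 a a =
          H.1.1 a a - simpleRoot r k H * (simpleCoroot r k).1.1 a a := rfl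
      rw [e, simpleCoroot_entry]
      change H.1.1 (Equiv.swap k.castSucc k.succ a) (Equiv.swap k.castSucc k.succ a) = _
      simp only [simpleRoot, LinearMap.sub_apply, diagEntry_apply]
      by_cases h1 : a = k.castSucc
      · subst h1
        simp [hne.symm]
      · by_cases h2 : a = k.succ
        · subst h2
          simp [hne]
        · rw [Equiv.swap_apply_of_ne_of_ne h1 h2]
          simp [Ne.symm h1, Ne.symm h2]
    rw [key, simpleReflection, Module.reflection_apply, LinearMap.sub_apply, map_sub, map_smul,
      LinearMap.smul_apply, Dual.eval_apply, smul_eq_mul, smul_eq_mul, mul_comm]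
  | one => exact ⟨1, fun l H => rfl⟩
  | mul w₁ w₂ _ _ h₁ h₂ =>
    obtain ⟨σ, hσ⟩ := h₁
    obtain ⟨τ, hτ⟩ := h₂
    refine ⟨σ * τ, fun l H => ?_⟩
    rw [LinearEquiv.mul_apply, hσ, hτ]
    rfl
  | inv w _ h =>
    obtain ⟨σ, hσ⟩ := h
    refine ⟨σ⁻¹, fun l H => ?_⟩
    have h1 := hσ (w⁻¹ l) (permute r σ⁻¹ H)
    have h2 : w (w⁻¹ l) = l := LinearEquiv.apply_symm_apply w l
    have h3 : permute r σ (permute r σ⁻¹ H) = H := by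
      apply cartan_ext
      intro a
      change H.1.1 (σ⁻¹ (σ a)) (σ⁻¹ (σ a)) = _
      simp
    rw [h2, h3] at h1
    exact h1.symm

instance finite_weylGroup (r : ℕ) : Finite (weylGroup r) := by
  choose f hf using fun w : weylGroup r => exists_perm r w.1 w.2
  apply Finite.of_injective f
  intro v w h
  apply Subtype.ext
  apply LinearEquiv.ext
  intro l
  apply LinearMap.ext
  intro H
  rw [hf v, hf w, h]

instance fintype_weylGroup (r : ℕ) : Fintype (weylGroup r) := Fintype.ofFinite _

/-- The `q`-multiplicity
`m_q(λ, μ) = ∑_{σ ∈ W} (-1)^{ℓ(σ)} ℘_q(σ(λ + ρ) - ρ - μ)`. -/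
def qMultiplicity (r : ℕ) (lam μ : Weight r) : Polynomial ℤ :=
  ∑ σ : weylGroup r, (-1) ^ length r σ * qPartition r (σ.1 (lam + rho r) - rho r - μ)

end

end TypeA

namespace TypeA

open Finset Module

noncomputable section

/-! The alternating sum over the Weyl group is the Leibniz expansion of a tridiagonal determinant,
which an explicit triangular factorization evaluates.

The Weyl group is the symmetric group on the coordinates `0, …, r`, and the sign is that of the
permutation. The coefficient of `σ⁻¹(α̃ + ρ) - ρ - μ` at the zero-based simple root `k` is the sum
of its first `k + 1` coordinates. It contains the sum of `b - σ b` over `b ≤ k`, which is never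
positive, while the other terms add up to at most one. If all coefficients are nonnegative, these
sums therefore lie in `{-1, 0}`, so `σ` moves every point by at most one and is a product of
disjoint adjacent transpositions. The transpositions compatible with nonnegativity avoid both end
pairs and the support of `μ` (`isAdmissible_of_nonneg`); all other permutations contribute zero.

For an admissible `σ` every coefficient is 0 or 1. Partitions of such a weight cut its support into
intervals, and a run of length `n` gives `q(1 + q)^(n - 1)` (`qPartition_simpleSum`). This product
is local, so it can be read off from the entries of a tridiagonal matrix along `σ`; zeros above the
diagonal remove the inadmissible permutations (`qPartition_shift`). The matrix is a product of an
upper unipotent, a lower bidiagonal and another upper unipotent factor (`transferMatrix_eq`), so its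
determinant is a product of ones and `q`s.

The weight space is spanned by one matrix unit, so both sides at `q = 1` equal one. -/

/-! ### The Weyl group as a symmetric group -/

/-- Simultaneous permutation of rows and columns, as a linear map. -/
def permuteLin (r : ℕ) (σ : Equiv.Perm (Fin (r + 1))) : cartan r →ₗ[ℂ] cartan r where
  toFun := permute r σ
  map_add' _ _ := rfl
  map_smul' _ _ := rfl

/-- The action of permutations of the coordinates on weights. -/
def permAction (r : ℕ) : Equiv.Perm (Fin (r + 1)) →* (Weight r ≃ₗ[ℂ] Weight r) where
  toFun σ :=
    { toFun := fun l => l ∘ₗ permuteLin r σ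
      map_add' := fun _ _ => rfl
      map_smul' := fun _ _ => rfl
      invFun := fun l => l ∘ₗ permuteLin r σ⁻¹
      left_inv := fun l => by
        ext H
        change l (permute r σ (permute r σ⁻¹ H)) = l H
        congr 1
        apply cartan_ext
        intro a
        change H.1.1 (σ⁻¹ (σ a)) (σ⁻¹ (σ a)) = _
        simp
      right_inv := fun l => by
        ext H
        change l (permute r σ⁻¹ (permute r σ H)) = l H
        congr 1
        apply cartan_ext
        intro a
        change H.1.1 (σ (σ⁻¹ a)) (σ (σ⁻¹ a)) = _
        simp }
  map_one' := rfl
  map_mul' _ _ := rfl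

lemma permAction_apply (r : ℕ) (σ : Equiv.Perm (Fin (r + 1))) (l : Weight r) (H : cartan r) :
    permAction r σ l H = l (permute r σ H) := rfl

lemma permAction_diagEntry (r : ℕ) (σ : Equiv.Perm (Fin (r + 1))) (a : Fin (r + 1)) :
    permAction r σ (diagEntry r a) = diagEntry r (σ a) := rfl

/-- The diagonal entries of `rhoCheck` are pairwise distinct. -/
lemma diagEntry_injective (r : ℕ) : Function.Injective (diagEntry r) := by
  intro a b h
  have h1 := congrArg (fun l : Weight r => l (rhoCheck r)) h
  simp only [diagEntry_apply, rhoCheck, Matrix.diagonal_apply_eq, sub_right_inj] at h1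
  exact Fin.ext (by exact_mod_cast h1)

lemma permAction_injective (r : ℕ) : Function.Injective (permAction r) := by
  intro σ τ h
  ext a
  have h1 := congrArg (fun w : Weight r ≃ₗ[ℂ] Weight r => w (diagEntry r a)) h
  simp only [permAction_diagEntry] at h1
  rw [diagEntry_injective r h1]

lemma permAction_swap (r : ℕ) (k : Fin r) :
    permAction r (Equiv.swap k.castSucc k.succ) = simpleReflection r k := by
  ext l H
  have hne : k.castSucc ≠ k.succ := k.castSucc_lt_succ.ne
  have key : permute r (Equiv.swap k.castSucc k.succ) H =
      H - (simpleRoot r k H) • simpleCoroot r k := by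
    apply cartan_ext
    intro a
    have e : (H - (simpleRoot r k H) • simpleCoroot r k).1.1 a a =
        H.1.1 a a - simpleRoot r k H * (simpleCoroot r k).1.1 a a := rfl
    rw [e, simpleCoroot_entry]
    change H.1.1 (Equiv.swap k.castSucc k.succ a) (Equiv.swap k.castSucc k.succ a) = _
    simp only [simpleRoot, LinearMap.sub_apply, diagEntry_apply]
    by_cases h1 : a = k.castSucc
    · subst h1
      simp [hne.symm]
    · by_cases h2 : a = k.succ
      · subst h2
        simp [hne]
      · rw [Equiv.swap_apply_of_ne_of_ne h1 h2]
        simp [Ne.symm h1, Ne.symm h2]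
  rw [permAction_apply, key, simpleReflection, Module.reflection_apply, LinearMap.sub_apply,
    map_sub, map_smul, LinearMap.smul_apply, Dual.eval_apply, smul_eq_mul, smul_eq_mul, mul_comm]

lemma permAction_mem (r : ℕ) (σ : Equiv.Perm (Fin (r + 1))) : permAction r σ ∈ weylGroup r := by
  have h : σ ∈ Submonoid.closure
      (Set.range fun k : Fin r => Equiv.swap k.castSucc k.succ) := by
    rw [Equiv.Perm.mclosure_swap_castSucc_succ]
    trivial
  induction h using Submonoid.closure_induction with
  | mem σ h =>
    obtain ⟨k, rfl⟩ := h
    simp only [permAction_swap]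
    exact Subgroup.subset_closure ⟨k, rfl⟩
  | one => rw [map_one]; exact one_mem _
  | mul σ τ _ _ h₁ h₂ => rw [map_mul]; exact mul_mem h₁ h₂

lemma exists_permAction_eq (r : ℕ) (w : weylGroup r) : ∃ σ, permAction r σ = w.1 := by
  obtain ⟨σ, hσ⟩ := exists_perm r w.1 w.2
  exact ⟨σ, by ext l H; rw [hσ, permAction_apply]⟩

/-- A word of minimal length becomes a product of that many adjacent transpositions, each of sign
`-1`. -/
lemma neg_one_pow_length (r : ℕ) (σ : Equiv.Perm (Fin (r + 1))) :
    (-1 : ℤˣ) ^ length r ⟨permAction r σ, permAction_mem r σ⟩ = Equiv.Perm.sign σ := by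
  obtain ⟨w, hw, hσ⟩ := exists_word r ⟨permAction r σ, permAction_mem r σ⟩
  have h : σ = (w.map fun k => Equiv.swap k.castSucc k.succ).prod := by
    apply permAction_injective
    refine Eq.trans hσ.symm ?_
    rw [map_list_prod, List.map_map]
    congr 2
    ext1 k
    exact (permAction_swap r k).symm
  rw [← hw, h, map_list_prod, List.map_map]
  have hs : (Equiv.Perm.sign ∘ fun k : Fin r => Equiv.swap k.castSucc k.succ) =
      fun _ => (-1 : ℤˣ) := by
    ext1 k
    exact Equiv.Perm.sign_swap k.castSucc_lt_succ.ne
  rw [hs, List.map_const', List.prod_replicate]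

/-- Summing over inverses makes the coordinate at `b` of the permuted weight the old coordinate at
`σ b`. -/
lemma qMultiplicity_eq_sum_perm (r : ℕ) (lam μ : Weight r) :
    qMultiplicity r lam μ = ∑ σ : Equiv.Perm (Fin (r + 1)), (Equiv.Perm.sign σ : ℤ) •
      qPartition r (permAction r σ⁻¹ (lam + rho r) - rho r - μ) := by
  have hb : Function.Bijective fun σ : Equiv.Perm (Fin (r + 1)) =>
      (⟨permAction r σ⁻¹, permAction_mem r σ⁻¹⟩ : weylGroup r) := by
    constructor
    · intro σ τ h
      exact inv_injective (permAction_injective r (congrArg Subtype.val h))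
    · intro w
      obtain ⟨σ, hσ⟩ := exists_permAction_eq r w
      exact ⟨σ⁻¹, Subtype.ext (by simp [hσ])⟩
  rw [qMultiplicity, ← hb.sum_comp]
  refine sum_congr rfl fun σ _ => ?_
  have h := congrArg (fun u : ℤˣ => ((u : ℤ) : Polynomial ℤ)) (neg_one_pow_length r σ⁻¹)
  simp only [Units.val_pow_eq_pow_val, Units.val_neg, Units.val_one, Int.cast_pow, Int.cast_neg,
    Int.cast_one, Equiv.Perm.sign_inv] at h
  rw [h, zsmul_eq_mul]

/-! ### Coordinates and simple-root coefficients -/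

/-- The `a`-th coordinate of `𝔥` as a weight, for a natural number `a` (zero for `a > r`). -/
def coordWeight (r a : ℕ) : Weight r := if h : a < r + 1 then diagEntry r ⟨a, h⟩ else 0

lemma coordWeight_val (r : ℕ) (a : Fin (r + 1)) : coordWeight r a = diagEntry r a := by
  rw [coordWeight, dif_pos a.2]

/-- The sum of the simple roots with (zero-based) index in `S`. -/
def simpleSum (r : ℕ) (S : Finset ℕ) : Weight r :=
  ∑ k ∈ S, (coordWeight r k - coordWeight r (k + 1))

/-- The element of `𝔥` on which `α_m` takes the value one for `m = k` and zero otherwise. -/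
def fundamentalCoweight (r k : ℕ) : cartan r :=
  ⟨⟨Matrix.diagonal fun a : Fin (r + 1) => (if (a : ℕ) ≤ k then 1 else 0) -
      (∑ b : Fin (r + 1), if (b : ℕ) ≤ k then 1 else 0) / ((r : ℂ) + 1), by
      change Matrix.trace (Matrix.diagonal fun a : Fin (r + 1) => (if (a : ℕ) ≤ k then 1 else 0) -
        (∑ b : Fin (r + 1), if (b : ℕ) ≤ k then 1 else 0) / ((r : ℂ) + 1)) = 0
      have h : (r : ℂ) + 1 ≠ 0 := by exact_mod_cast r.succ_ne_zero
      rw [Matrix.trace_diagonal, sum_sub_distrib, sum_const, card_univ, Fintype.card_fin,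
        nsmul_eq_mul]
      push_cast
      rw [mul_div_cancel₀ _ h, sub_self]⟩,
    Matrix.isDiag_diagonal _⟩

/-- The coefficient of a weight at the `k`-th simple root. -/
def coeffAt (r k : ℕ) : Weight r →+ ℝ where
  toFun l := (l (fundamentalCoweight r k)).re
  map_zero' := rfl
  map_add' _ _ := rfl

/-- The mean subtracted in `fundamentalCoweight` to obtain trace zero cancels in a difference of two
coordinates. -/
lemma coeffAt_diagEntry_sub (r k : ℕ) (a b : Fin (r + 1)) :
    coeffAt r k (diagEntry r a - diagEntry r b) =
      (if (a : ℕ) ≤ k then 1 else 0) - (if (b : ℕ) ≤ k then 1 else 0) := by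
  simp only [coeffAt, AddMonoidHom.coe_mk, ZeroHom.coe_mk, LinearMap.sub_apply, diagEntry_apply,
    fundamentalCoweight, Matrix.diagonal_apply_eq, sub_sub_sub_cancel_right]
  split_ifs <;> simp

lemma coeffAt_rootSum (r k : ℕ) {i j : Fin r} (h : i ≤ j) :
    coeffAt r k (rootSum r i j) = if (i : ℕ) ≤ k ∧ k ≤ j then 1 else 0 := by
  have h' : (i : ℕ) ≤ j := h
  rw [rootSum_eq r i j h, coeffAt_diagEntry_sub]
  simp only [Fin.val_castSucc, Fin.val_succ]
  split_ifs <;> first | omega | norm_num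

lemma coeffAt_simpleSum {r : ℕ} {S : Finset ℕ} (hS : S ⊆ range r) (k : ℕ) :
    coeffAt r k (simpleSum r S) = if k ∈ S then 1 else 0 := by
  rw [simpleSum, map_sum, ← sum_ite_eq S k fun _ => (1 : ℝ)]
  refine sum_congr rfl fun m hm => ?_
  have hm' : m < r := mem_range.1 (hS hm)
  have h := coeffAt_diagEntry_sub r k ⟨m, by omega⟩ ⟨m + 1, by omega⟩
  rw [← coordWeight_val, ← coordWeight_val] at h
  rw [h]
  simp only
  split_ifs <;> first | omega | norm_num

lemma rootSum_eq_coordWeight (r : ℕ) {i j : Fin r} (h : i ≤ j) :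
    rootSum r i j = coordWeight r i - coordWeight r (j + 1) := by
  rw [rootSum_eq r i j h, ← coordWeight_val, ← coordWeight_val]
  rfl

lemma rootSum_eq_simpleSum (r : ℕ) {i j : Fin r} (h : i ≤ j) :
    rootSum r i j = simpleSum r (Icc (i : ℕ) j) := by
  have h' : (i : ℕ) ≤ j := h
  rw [rootSum_eq_coordWeight r h, simpleSum, ← Ico_add_one_right_eq_Icc, ← neg_inj,
    ← sum_neg_distrib, neg_sub]
  simp only [neg_sub]
  rw [Finset.sum_Ico_sub (coordWeight r) (by omega)]

lemma rootSum_inj (r : ℕ) {i j i' j' : Fin r} (h : i ≤ j) (h' : i' ≤ j')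
    (e : rootSum r i j = rootSum r i' j') : i = i' ∧ j = j' := by
  have hc : ∀ k : ℕ, ((i : ℕ) ≤ k ∧ k ≤ j) ↔ ((i' : ℕ) ≤ k ∧ k ≤ j') := by
    intro k
    have := congrArg (coeffAt r k) e
    rw [coeffAt_rootSum r k h, coeffAt_rootSum r k h'] at this
    split_ifs at this with h1 h2 h2
    · exact iff_of_true h1 h2
    · norm_num at this
    · norm_num at this
    · exact iff_of_false h1 h2
  have h1 : (i : ℕ) ≤ j := h
  have h2 : (i' : ℕ) ≤ j' := h'
  have := hc i
  have := hc i'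
  have := hc j
  have := hc j'
  constructor <;> apply Fin.ext <;> omega

/-- The coordinate `a` occurs positively in the `r - a` roots starting there and negatively in the
`a` roots ending there. -/
lemma sum_positiveRoots (r : ℕ) :
    ∑ α ∈ positiveRoots r, α = ∑ a : Fin (r + 1), ((r : ℂ) - 2 * a) • diagEntry r a := by
  classical
  have h1 : ∑ α ∈ positiveRoots r, α =
      ∑ p ∈ univ.filter fun p : Fin r × Fin r => p.1 ≤ p.2, rootSum r p.1 p.2 := by
    rw [positiveRoots, sum_image]
    intro p hp q hq e
    simp only [coe_filter, mem_univ, true_and, Set.mem_ofPred_eq] at hp hq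
    exact Prod.ext_iff.2 (rootSum_inj r hp hq e)
  have h2 : ∀ a : Fin r, (∑ b : Fin r, if a ≤ b then diagEntry r a.castSucc else 0) =
      ((r : ℂ) - a) • diagEntry r a.castSucc := by
    intro a
    rw [← sum_filter, filter_le_eq_Ici, sum_const, Fin.card_Ici, ← Nat.cast_smul_eq_nsmul ℂ,
      Nat.cast_sub a.2.le]
  have h3 : ∀ b : Fin r, (∑ a : Fin r, if a ≤ b then diagEntry r b.succ else 0) =
      ((b : ℂ) + 1) • diagEntry r b.succ := by
    intro b
    rw [← sum_filter, filter_ge_eq_Iic, sum_const, Fin.card_Iic, ← Nat.cast_smul_eq_nsmul ℂ]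
    push_cast
    rfl
  have h4 : ∑ a : Fin (r + 1), ((r : ℂ) - 2 * a) • diagEntry r a =
      ∑ a : Fin (r + 1), ((r : ℂ) - a) • diagEntry r a -
        ∑ a : Fin (r + 1), (a : ℂ) • diagEntry r a := by
    rw [← sum_sub_distrib]
    refine sum_congr rfl fun a _ => ?_
    rw [← sub_smul]
    congr 1
    ring
  rw [h1, h4, Fin.sum_univ_castSucc, Fin.sum_univ_succ (fun a => (a : ℂ) • diagEntry r a),
    sum_filter, Fintype.sum_prod_type]
  simp only [Fin.val_castSucc, Fin.val_last, sub_self, zero_smul, add_zero, Fin.coe_ofNat_eq_mod,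
    Nat.zero_mod, Nat.cast_zero, zero_add, Fin.val_succ, Nat.cast_add, Nat.cast_one]
  simp only [← h2, ← h3]
  rw [sum_comm (f := fun b a : Fin r => if a ≤ b then diagEntry r b.succ else 0),
    ← sum_sub_distrib]
  refine sum_congr rfl fun a _ => ?_
  rw [← sum_sub_distrib]
  refine sum_congr rfl fun b _ => ?_
  split_ifs with h
  · exact rootSum_eq r a b h
  · rw [sub_zero]

lemma rho_eq (r : ℕ) :
    rho r = ∑ a : Fin (r + 1), ((r : ℂ) / 2 - a) • diagEntry r a := by
  rw [rho, sum_positiveRoots, smul_sum]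
  refine sum_congr rfl fun a _ => ?_
  rw [smul_smul]
  congr 1
  ring

lemma highestRoot_eq (r : ℕ) (hr : 1 ≤ r) :
    highestRoot r = coordWeight r 0 - coordWeight r r := by
  have e : highestRoot r = rootSum r ⟨0, hr⟩ ⟨r - 1, by omega⟩ := by
    rw [highestRoot, rootSum]
    congr 1
    ext x
    simp [Fin.le_def]
    omega
  rw [e, rootSum_eq_coordWeight r (Nat.zero_le _)]
  simp only [Nat.sub_add_cancel hr]

/-- Abel summation. When the coordinates add up to zero, it identifies the simple-root coefficients
with partial sums of coordinates. -/
lemma sum_smul_by_parts {M : Type*} [AddCommGroup M] (x : ℕ → ℤ) (e : ℕ → M) (n : ℕ) :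
    ∑ b ∈ range (n + 1), x b • e b = (∑ b ∈ range (n + 1), x b) • e n +
      ∑ k ∈ range n, (∑ b ∈ range (k + 1), x b) • (e k - e (k + 1)) := by
  induction n with
  | zero => simp
  | succ n ih =>
    rw [sum_range_succ, ih, sum_range_succ x (n + 1),
      sum_range_succ (fun k => (∑ b ∈ range (k + 1), x b) • (e k - e (k + 1))) n, smul_sub, add_smul]
    abel

lemma coeffAt_sum {r : ℕ} (x : ℕ → ℤ) (hx : ∑ b ∈ range (r + 1), x b = 0) {k : ℕ} (hk : k < r) :
    coeffAt r k (∑ b ∈ range (r + 1), x b • coordWeight r b) =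
      ((∑ b ∈ range (k + 1), x b : ℤ) : ℝ) := by
  rw [sum_smul_by_parts, hx, zero_smul, zero_add, map_sum]
  have h : ∀ m ∈ range r, coeffAt r k ((∑ b ∈ range (m + 1), x b) •
      (coordWeight r m - coordWeight r (m + 1))) =
        if k = m then ((∑ b ∈ range (m + 1), x b : ℤ) : ℝ) else 0 := by
    intro m hm
    have h1 := coeffAt_simpleSum (S := {m}) (by simpa using hm) k
    rw [simpleSum, sum_singleton] at h1
    rw [map_zsmul, h1]
    simp
  rw [sum_congr rfl h, sum_ite_eq, if_pos (mem_range.2 hk)]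

lemma sum_eq_simpleSum {r : ℕ} (x : ℕ → ℤ) (hx : ∑ b ∈ range (r + 1), x b = 0) (S : Finset ℕ)
    (hS : S ⊆ range r)
    (h : ∀ k < r, ∑ b ∈ range (k + 1), x b = if k ∈ S then 1 else 0) :
    ∑ b ∈ range (r + 1), x b • coordWeight r b = simpleSum r S := by
  rw [sum_smul_by_parts, hx, zero_smul, zero_add, simpleSum, ← sum_subset hS]
  · refine sum_congr rfl fun k hk => ?_
    rw [h k (mem_range.1 (hS hk)), if_pos hk, one_smul]
  · intro k hk hk'
    rw [h k (mem_range.1 hk), if_neg hk', zero_smul]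

/-! ### Coordinates of the shifted weight -/

/-- The coordinates of `σ⁻¹(α̃ + ρ) - ρ - (α_i + ⋯ + α_j)`. -/
def shiftCoord (r i j : ℕ) (τ : Equiv.Perm ℕ) (b : ℕ) : ℤ :=
  (if τ b = 0 then 1 else 0) - (if τ b = r then 1 else 0) + b - τ b -
    (if b = i then 1 else 0) + (if b = j + 1 then 1 else 0)

/-- A permutation of `{0, …, r}` as a permutation of `ℕ`. -/
def natPerm {r : ℕ} (σ : Equiv.Perm (Fin (r + 1))) : Equiv.Perm ℕ :=
  σ.extendDomain Fin.equivSubtype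

lemma natPerm_val {r : ℕ} (σ : Equiv.Perm (Fin (r + 1))) (b : Fin (r + 1)) :
    natPerm σ b = σ b :=
  σ.extendDomain_apply_image Fin.equivSubtype b

lemma natPerm_of_lt {r : ℕ} (σ : Equiv.Perm (Fin (r + 1))) {b : ℕ} (hb : r < b) :
    natPerm σ b = b :=
  σ.extendDomain_apply_not_subtype Fin.equivSubtype (by omega)

/-- The constant `r / 2` in the coordinates of `ρ` cancels, which leaves the integer `b - σ b`. -/
lemma weight_eq_sum_shiftCoord (r : ℕ) (i j : Fin r) (hij : i ≤ j)
    (σ : Equiv.Perm (Fin (r + 1))) :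
    permAction r σ⁻¹ (highestRoot r + rho r) - rho r - rootSum r i j =
      ∑ b ∈ range (r + 1), shiftCoord r i j (natPerm σ) b • coordWeight r b := by
  have hr : 1 ≤ r := by have := i.2; omega
  have single : ∀ m : ℕ, m < r + 1 →
      coordWeight r m = ∑ a : Fin (r + 1), (if (a : ℕ) = m then (1 : ℂ) else 0) • diagEntry r a := by
    intro m hm
    rw [sum_eq_single ⟨m, hm⟩]
    · simp [coordWeight, hm]
    · intro b _ hb
      rw [if_neg fun h => hb (Fin.ext h), zero_smul]
    · simp
  have perm : ∀ v : Fin (r + 1) → ℂ, permAction r σ⁻¹ (∑ a, v a • diagEntry r a) =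
      ∑ b, v (σ b) • diagEntry r b := by
    intro v
    rw [map_sum, ← Equiv.sum_comp σ]
    refine sum_congr rfl fun b _ => ?_
    rw [map_smul, permAction_diagEntry, Equiv.Perm.inv_def, Equiv.symm_apply_apply]
  rw [rho_eq, highestRoot_eq r hr, rootSum_eq_coordWeight r hij, single 0 (by omega),
    single r (by omega), single i (by omega), single (j + 1) (by omega), ← sum_sub_distrib,
    ← sum_sub_distrib]
  simp only [← sub_smul]
  rw [← sum_add_distrib]
  simp only [← add_smul]
  rw [perm, ← sum_sub_distrib, ← sum_sub_distrib, ← Fin.sum_univ_eq_sum_range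
    (fun b => shiftCoord r i j (natPerm σ) b • coordWeight r b)]
  refine sum_congr rfl fun b _ => ?_
  rw [coordWeight_val, ← Int.cast_smul_eq_zsmul ℂ, ← sub_smul, ← sub_smul, shiftCoord, natPerm_val]
  congr 1
  push_cast
  ring

/-! ### Kostant's partition function on sums of distinct simple roots -/

lemma coeffAt_nonneg {r : ℕ} (k : ℕ) {α : Weight r} (hα : α ∈ positiveRoots r) :
    0 ≤ coeffAt r k α := by
  classical
  obtain ⟨⟨i, j⟩, hij, rfl⟩ := mem_image.1 hα
  rw [coeffAt_rootSum r k (by simpa using hij)]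
  split_ifs <;> norm_num

lemma coeffAt_le_sum {r : ℕ} (k : ℕ) {m : Multiset (Weight r)}
    (hm : ∀ α ∈ m, α ∈ positiveRoots r) {α : Weight r} (hα : α ∈ m) :
    coeffAt r k α ≤ coeffAt r k m.sum := by
  rw [map_multiset_sum]
  apply Multiset.single_le_sum
  · intro x hx
    obtain ⟨β, hβ, rfl⟩ := Multiset.mem_map.1 hx
    exact coeffAt_nonneg k (hm β hβ)
  · exact Multiset.mem_map_of_mem _ hα

lemma qPartition_eq_zero {r k : ℕ} {ξ : Weight r} (h : coeffAt r k ξ < 0) :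
    qPartition r ξ = 0 := by
  ext n
  rw [coeff_qPartition, Polynomial.coeff_zero]
  norm_cast
  by_contra h0
  obtain ⟨m, hm, -, rfl⟩ := (Nat.card_ne_zero.1 h0).1
  apply h.not_ge
  rw [map_multiset_sum]
  apply Multiset.sum_nonneg
  intro x hx
  obtain ⟨β, hβ, rfl⟩ := Multiset.mem_map.1 hx
  exact coeffAt_nonneg k (hm β hβ)

lemma simpleSum_Icc_mem {r a b : ℕ} (hab : a ≤ b) (hb : b < r) :
    simpleSum r (Icc a b) ∈ positiveRoots r := by
  have h : (⟨a, by omega⟩ : Fin r) ≤ ⟨b, hb⟩ := hab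
  have := rootSum_mem r h
  rwa [rootSum_eq_simpleSum r h] at this

lemma simpleSum_Icc_inj {r a b b' : ℕ} (hab : a ≤ b) (hb : b < r) (hab' : a ≤ b') (hb' : b' < r)
    (h : simpleSum r (Icc a b) = simpleSum r (Icc a b')) : b = b' := by
  have h1 : (⟨a, by omega⟩ : Fin r) ≤ ⟨b, hb⟩ := hab
  have h2 : (⟨a, by omega⟩ : Fin r) ≤ ⟨b', hb'⟩ := hab'
  have e := (rootSum_eq_simpleSum r h1).trans (h.trans (rootSum_eq_simpleSum r h2).symm)
  exact congrArg Fin.val (rootSum_inj r h1 h2 e).2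

lemma qPartition_zero (r : ℕ) : qPartition r 0 = 1 := by
  ext n
  rw [coeff_qPartition, Polynomial.coeff_one]
  split_ifs with h
  · subst h
    norm_cast
    rw [partitionCount, Nat.card_eq_one_iff_unique]
    refine ⟨⟨fun a b => Subtype.ext ?_⟩, ⟨0, by simp⟩⟩
    rw [Multiset.card_eq_zero.1 a.2.2.1, Multiset.card_eq_zero.1 b.2.2.1]
  · norm_cast
    by_contra h0
    obtain ⟨m, hm, rfl, hs⟩ := (Nat.card_ne_zero.1 h0).1
    have h1 := card_le_of_sum_eq r m hm
    rw [hs] at h1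
    simp only [LinearMap.zero_apply, Complex.zero_re, Nat.cast_nonpos] at h1
    exact h h1

/-- Splitting off the positive root through the smallest element of the support. -/
lemma partitionCount_simpleSum {r : ℕ} {S : Finset ℕ} (hS : S ⊆ range r) {b : ℕ} (hb : b ∈ S)
    (hmin : ∀ k ∈ S, b ≤ k) (n : ℕ) :
    partitionCount r (simpleSum r S) (n + 1) =
      ∑ a ∈ S with Icc b a ⊆ S, partitionCount r (simpleSum r (S \ Icc b a)) n := by
  have hsub : ∀ a, S \ Icc b a ⊆ range r := fun a => sdiff_subset.trans hS
  have hmem : ∀ a : {a // a ∈ S.filter fun a => Icc b a ⊆ S},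
      b ≤ a.1 ∧ a.1 < r ∧ Icc b a.1 ⊆ S := by
    rintro ⟨a, ha⟩
    have ha' := mem_filter.1 ha
    exact ⟨hmin a ha'.1, mem_range.1 (hS ha'.1), ha'.2⟩
  have := fun a : {a // a ∈ S.filter fun a => Icc b a ⊆ S} =>
    finite_partitions r (simpleSum r (S \ Icc b a.1)) n
  rw [← sum_coe_sort]
  unfold partitionCount
  rw [← Nat.card_sigma]
  symm
  let f : (Σ a : {a // a ∈ S.filter fun a => Icc b a ⊆ S}, {m : Multiset (Weight r) //
      (∀ α ∈ m, α ∈ positiveRoots r) ∧ m.card = n ∧ m.sum = simpleSum r (S \ Icc b a.1)}) →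
      {m : Multiset (Weight r) //
      (∀ α ∈ m, α ∈ positiveRoots r) ∧ m.card = n + 1 ∧ m.sum = simpleSum r S} := fun p =>
    ⟨simpleSum r (Icc b p.1.1) ::ₘ p.2.1, by
      obtain ⟨h1, h2, h3⟩ := hmem p.1
      refine ⟨?_, ?_, ?_⟩
      · intro α hα
        rcases Multiset.mem_cons.1 hα with rfl | hα
        · exact simpleSum_Icc_mem h1 h2
        · exact p.2.2.1 α hα
      · rw [Multiset.card_cons, p.2.2.2.1]
      · rw [Multiset.sum_cons, p.2.2.2.2, add_comm]
        exact sum_sdiff h3⟩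
  apply Nat.card_eq_of_bijective f
  constructor
  · rintro ⟨a, m, hm⟩ ⟨a', m', hm'⟩ h
    obtain ⟨h1, h2, h3⟩ := hmem a
    obtain ⟨h1', h2', h3'⟩ := hmem a'
    have h : simpleSum r (Icc b a.1) ::ₘ m = simpleSum r (Icc b a'.1) ::ₘ m' :=
      congrArg Subtype.val h
    rcases Multiset.cons_eq_cons.1 h with ⟨e, rfl⟩ | ⟨-, cs, hcs, -⟩
    · obtain rfl := Subtype.ext (simpleSum_Icc_inj h1 h2 h1' h2' e)
      rfl
    · exfalso
      -- A second root through `b` would lie in `m`, whose sum has coefficient zero at `b`.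
      have h4 : simpleSum r (Icc b a'.1) ∈ m := by rw [hcs]; exact Multiset.mem_cons_self _ _
      have h5 := coeffAt_le_sum b hm.1 h4
      rw [hm.2.2, coeffAt_simpleSum (hsub _), coeffAt_simpleSum (h3'.trans hS),
        if_pos (left_mem_Icc.2 h1'), if_neg (by simp [h1])] at h5
      norm_num at h5
  · rintro ⟨m, hm, hc, hs⟩
    -- Since the total has coefficient one at `b`, some part passes through `b`. Its support lies in
    -- `S` because coefficients cannot cancel, so it starts at the minimum `b`.
    obtain ⟨β, hβ, hβb⟩ : ∃ β ∈ m, coeffAt r b β ≠ 0 := by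
      by_contra! h0
      have h1 : coeffAt r b m.sum = 0 := by
        rw [map_multiset_sum]
        apply Multiset.sum_eq_zero
        intro x hx
        obtain ⟨β, hβ, rfl⟩ := Multiset.mem_map.1 hx
        exact h0 β hβ
      rw [hs, coeffAt_simpleSum hS, if_pos hb] at h1
      norm_num at h1
    obtain ⟨i, j, hij, rfl⟩ : ∃ i j : Fin r, i ≤ j ∧ rootSum r i j = β := by
      classical
      obtain ⟨⟨i, j⟩, hij, rfl⟩ := mem_image.1 (hm β hβ)
      exact ⟨i, j, by simpa using hij, rfl⟩
    have hib : (i : ℕ) ≤ b ∧ b ≤ j := by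
      by_contra h0
      rw [coeffAt_rootSum r b hij, if_neg h0] at hβb
      exact hβb rfl
    have hsupp : ∀ k : ℕ, (i : ℕ) ≤ k → k ≤ j → k ∈ S := by
      intro k h1 h2
      by_contra h0
      have h3 := coeffAt_le_sum k hm hβ
      rw [hs, coeffAt_simpleSum hS, if_neg h0, coeffAt_rootSum r k hij, if_pos ⟨h1, h2⟩] at h3
      norm_num at h3
    have hi : (i : ℕ) = b := le_antisymm hib.1 (hmin _ (hsupp i le_rfl hij))
    have hI : Icc b (j : ℕ) ⊆ S := by
      intro k hk
      rw [mem_Icc] at hk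
      exact hsupp k (by omega) hk.2
    have hj : (j : ℕ) ∈ S.filter fun a => Icc b a ⊆ S :=
      mem_filter.2 ⟨hsupp j hij le_rfl, hI⟩
    have hroot : rootSum r i j = simpleSum r (Icc b j) := by
      rw [rootSum_eq_simpleSum r hij, hi]
    obtain ⟨t, rfl⟩ := Multiset.exists_cons_of_mem hβ
    have hs' : simpleSum r (S \ Icc b j) + simpleSum r (Icc b j) = simpleSum r S := sum_sdiff hI
    refine ⟨⟨⟨j, hj⟩, t, fun α hα => hm α (Multiset.mem_cons_of_mem hα), by simpa using hc, ?_⟩,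
      Subtype.ext ?_⟩
    · rw [Multiset.sum_cons, hroot, ← hs', add_comm] at hs
      exact add_right_cancel hs
    · exact congrArg (· ::ₘ t) hroot.symm

/-- The factor `X` counts the root that is split off; the constant term vanishes because the weight
is nonzero. -/
lemma qPartition_simpleSum_rec {r : ℕ} {S : Finset ℕ} (hS : S ⊆ range r) {b : ℕ} (hb : b ∈ S)
    (hmin : ∀ k ∈ S, b ≤ k) :
    qPartition r (simpleSum r S) =
      Polynomial.X * ∑ a ∈ S with Icc b a ⊆ S, qPartition r (simpleSum r (S \ Icc b a)) := by
  ext n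
  cases n with
  | zero =>
    rw [Polynomial.coeff_X_mul_zero, coeff_qPartition]
    norm_cast
    by_contra h0
    obtain ⟨m, -, hc, hs⟩ := (Nat.card_ne_zero.1 h0).1
    rw [Multiset.card_eq_zero.1 hc, Multiset.sum_zero] at hs
    have h1 := coeffAt_simpleSum hS b
    rw [← hs, map_zero, if_pos hb] at h1
    norm_num at h1
  | succ n =>
    rw [Polynomial.coeff_X_mul, coeff_qPartition, Polynomial.finsetSum_coeff,
      partitionCount_simpleSum hS hb hmin]
    simp only [coeff_qPartition]
    push_cast
    rfl

/-- The generating function for partitions of `S` into intervals. -/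
def intervalPoly (S : Finset ℕ) : Polynomial ℤ :=
  ∏ k ∈ S, if k + 1 ∈ S then 1 + Polynomial.X else Polynomial.X

lemma intervalPoly_erase {S : Finset ℕ} {b : ℕ} (hb : b ∈ S) (hmin : ∀ k ∈ S, b ≤ k) :
    intervalPoly S =
      (if b + 1 ∈ S then 1 + Polynomial.X else Polynomial.X) * intervalPoly (S.erase b) := by
  rw [intervalPoly, ← mul_prod_erase S _ hb]
  congr 1
  refine prod_congr rfl fun k hk => ?_
  have h1 : k + 1 ∈ S.erase b ↔ k + 1 ∈ S := by
    have := hmin k (mem_of_mem_erase hk)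
    rw [mem_erase]
    exact and_iff_right (by omega)
  simp only [h1]

/-- The first interval is either `{b}` alone, contributing `X` times the polynomial of `S.erase b`,
or it continues to `b + 1`. Deleting `b` from the longer intervals gives the recursion for `S.erase
b`, hence the summand 1 in `1 + X`. -/
lemma intervalPoly_rec (n : ℕ) : ∀ {S : Finset ℕ}, S.card = n → ∀ {b : ℕ}, b ∈ S →
    (∀ k ∈ S, b ≤ k) →
    intervalPoly S = Polynomial.X * ∑ a ∈ S with Icc b a ⊆ S, intervalPoly (S \ Icc b a) := by
  induction n with
  | zero =>
    intro S hS b hb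
    rw [card_eq_zero] at hS
    simp [hS] at hb
  | succ n ih =>
    intro S hS b hb hmin
    have hsd : S \ Icc b b = S.erase b := by rw [Icc_self, sdiff_singleton_eq_erase]
    rw [intervalPoly_erase hb hmin]
    split_ifs with h
    · have hb' : b + 1 ∈ S.erase b := mem_erase.2 ⟨by omega, h⟩
      have hmin' : ∀ k ∈ S.erase b, b + 1 ≤ k := by
        intro k hk
        have h1 := hmin k (mem_of_mem_erase hk)
        have h2 := ne_of_mem_erase hk
        omega
      have hA : S.filter (fun a => Icc b a ⊆ S) = insert b
          ((S.erase b).filter fun a => Icc (b + 1) a ⊆ S.erase b) := by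
        ext a
        simp only [mem_filter, mem_insert, mem_erase, subset_iff, mem_Icc]
        constructor
        · rintro ⟨h1, h2⟩
          by_cases hab : a = b
          · exact Or.inl hab
          · exact Or.inr ⟨⟨hab, h1⟩, fun k hk => ⟨by omega, h2 ⟨by omega, hk.2⟩⟩⟩
        · rintro (rfl | ⟨⟨h1, h2⟩, h3⟩)
          · refine ⟨hb, fun k hk => ?_⟩
            obtain rfl : k = a := by omega
            exact hb
          · refine ⟨h2, fun k hk => ?_⟩
            by_cases hkb : k = b
            · rwa [hkb]
            · exact (h3 ⟨by omega, hk.2⟩).2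
      rw [hA, sum_insert (by simp), hsd, mul_add, add_mul, one_mul, add_comm]
      congr 1
      rw [ih (by rw [card_erase_of_mem hb, hS]; rfl) hb' hmin']
      congr 1
      refine sum_congr rfl fun a ha => ?_
      congr 1
      have := hmin' a (mem_filter.1 ha).1
      ext k
      simp only [mem_sdiff, mem_erase, mem_Icc]
      constructor
      · rintro ⟨⟨h1, h2⟩, h3⟩
        exact ⟨h2, by omega⟩
      · rintro ⟨h1, h2⟩
        exact ⟨⟨by omega, h1⟩, by omega⟩
    · have hA : S.filter (fun a => Icc b a ⊆ S) = {b} := by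
        ext a
        simp only [mem_filter, mem_singleton, subset_iff, mem_Icc]
        constructor
        · rintro ⟨h1, h2⟩
          by_contra hab
          have := hmin a h1
          exact h (h2 ⟨by omega, by omega⟩)
        · rintro rfl
          refine ⟨hb, fun k hk => ?_⟩
          obtain rfl : k = a := by omega
          exact hb
      rw [hA, sum_singleton, hsd]

/-- Kostant's partition function on sums of distinct simple roots. -/
lemma qPartition_simpleSum {r : ℕ} {S : Finset ℕ} (hS : S ⊆ range r) :
    qPartition r (simpleSum r S) = intervalPoly S := by
  induction S using Finset.strongInduction with
  | H S ih =>
    rcases S.eq_empty_or_nonempty with rfl | hne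
    · rw [simpleSum, sum_empty, qPartition_zero, intervalPoly, prod_empty]
    · have hmin : ∀ k ∈ S, S.min' hne ≤ k := fun k hk => min'_le S k hk
      have hb := S.min'_mem hne
      rw [qPartition_simpleSum_rec hS hb hmin, intervalPoly_rec _ rfl hb hmin]
      congr 1
      refine sum_congr rfl fun a ha => ih _ ?_ (sdiff_subset.trans hS)
      refine sdiff_ssubset (mem_filter.1 ha).2 ⟨S.min' hne, ?_⟩
      exact left_mem_Icc.2 (hmin a (mem_filter.1 ha).1)

/-! ### Permutations with nonnegative coefficients -/

/-- Every element is moved by at most one. -/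
def IsBand (τ : Equiv.Perm ℕ) : Prop := ∀ b, τ b ≤ b + 1 ∧ b ≤ τ b + 1

/-- The value `k` is taken at `k - 1`, `k` or `k + 1`. The hypothesis excludes `k`, and induction
excludes `k - 1`, which would force `τ k = k - 1`. -/
lemma IsBand.apply_succ {τ : Equiv.Perm ℕ} (h : IsBand τ) {k : ℕ} (hk : τ k = k + 1) :
    τ (k + 1) = k := by
  induction k with
  | zero =>
    have h1 : τ (τ.symm 0) = 0 := τ.apply_symm_apply 0
    have h2 := h (τ.symm 0)
    rw [h1] at h2
    have h3 : τ.symm 0 ≠ 0 := fun e => by rw [e] at h1; omega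
    have h4 : τ.symm 0 = 0 + 1 := by omega
    rwa [h4] at h1
  | succ k ih =>
    have h1 : τ (τ.symm (k + 1)) = k + 1 := τ.apply_symm_apply _
    have h2 := h (τ.symm (k + 1))
    rw [h1] at h2
    have h3 : τ.symm (k + 1) ≠ k + 1 := fun e => by rw [e] at h1; omega
    have h4 : τ.symm (k + 1) ≠ k := fun e => by
      rw [e] at h1
      have := ih h1
      omega
    have h5 : τ.symm (k + 1) = k + 1 + 1 := by omega
    rwa [h5] at h1

lemma IsBand.symm {τ : Equiv.Perm ℕ} (h : IsBand τ) : IsBand τ.symm := by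
  intro b
  have h1 := h (τ.symm b)
  rw [τ.apply_symm_apply] at h1
  omega

lemma IsBand.apply_of_succ {τ : Equiv.Perm ℕ} (h : IsBand τ) {k : ℕ} (hk : τ (k + 1) = k) :
    τ k = k + 1 := by
  have h1 : τ.symm k = k + 1 := τ.symm_apply_eq.2 hk.symm
  exact (τ.symm_apply_eq.1 (h.symm.apply_succ h1)).symm

/-- A transposition lying inside the range contributes zero; only one cut by its right end leaves
`-1`. -/
lemma IsBand.sum_sub {τ : Equiv.Perm ℕ} (h : IsBand τ) (k : ℕ) :
    ∑ b ∈ range (k + 1), ((b : ℤ) - τ b) = if τ k = k + 1 then -1 else 0 := by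
  induction k with
  | zero =>
    have := h 0
    simp only [zero_add, sum_range_one]
    split_ifs <;> omega
  | succ k ih =>
    rw [sum_range_succ, ih]
    have h1 := h (k + 1)
    have h2 : τ k = k + 1 ↔ τ (k + 1) = k := ⟨h.apply_succ, h.apply_of_succ⟩
    simp only [h2]
    split_ifs <;> omega

lemma sum_ite_perm (τ : Equiv.Perm ℕ) (c k : ℕ) :
    ∑ b ∈ range (k + 1), (if τ b = c then (1 : ℤ) else 0) = if τ.symm c ≤ k then 1 else 0 := by
  have h : ∀ b, τ b = c ↔ τ.symm c = b := fun b => by rw [τ.symm_apply_eq, eq_comm]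
  simp only [h, sum_ite_eq, mem_range, Nat.lt_succ_iff]

lemma sum_shiftCoord (r i j : ℕ) (τ : Equiv.Perm ℕ) (k : ℕ) :
    ∑ b ∈ range (k + 1), shiftCoord r i j τ b =
      (if τ.symm 0 ≤ k then 1 else 0) - (if τ.symm r ≤ k then 1 else 0) +
        ∑ b ∈ range (k + 1), ((b : ℤ) - τ b) -
        (if i ≤ k then 1 else 0) + (if j + 1 ≤ k then 1 else 0) := by
  rw [← sum_ite_perm τ 0 k, ← sum_ite_perm τ r k]
  have h : ∀ c, (if c ≤ k then (1 : ℤ) else 0) = ∑ b ∈ range (k + 1), if b = c then 1 else 0 := by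
    intro c
    simp only [sum_ite_eq', mem_range, Nat.lt_succ_iff]
  rw [h, h, ← sum_sub_distrib, ← sum_add_distrib, ← sum_sub_distrib, ← sum_add_distrib]
  refine sum_congr rfl fun b _ => ?_
  rw [shiftCoord]
  ring

/-- Among sets of `n` distinct natural numbers, `{0, …, n - 1}` has the least sum. -/
lemma sum_sub_nonpos (τ : Equiv.Perm ℕ) (n : ℕ) : ∑ b ∈ range n, ((b : ℤ) - τ b) ≤ 0 := by
  have hinj : Function.Injective fun b : ℕ => (τ b : ℤ) := fun a b h =>
    τ.injective (Int.ofNat_injective h)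
  have h := sum_range_le_sum (s := (range n).image fun b : ℕ => (τ b : ℤ)) (c := 0) (by
    intro x hx
    obtain ⟨b, -, rfl⟩ := mem_image.1 hx
    positivity)
  rw [card_image_of_injective _ hinj, card_range, sum_image fun a _ b _ e => hinj e] at h
  rw [sum_sub_distrib]
  simp only [zero_add] at h
  linarith

lemma symm_le {τ : Equiv.Perm ℕ} {r : ℕ} (hτ : ∀ b, r < b → τ b = b) {c : ℕ} (hc : c ≤ r) :
    τ.symm c ≤ r := by
  by_contra! h
  have := hτ _ h
  rw [τ.apply_symm_apply] at this
  omega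

lemma apply_le {τ : Equiv.Perm ℕ} {r : ℕ} (hτ : ∀ b, r < b → τ b = b) {c : ℕ} (hc : c ≤ r) :
    τ c ≤ r := by
  by_contra! h
  have := τ.injective (hτ _ h)
  omega

lemma sum_sub_eq_zero {τ : Equiv.Perm ℕ} {r : ℕ} (hτ : ∀ b, r < b → τ b = b) :
    ∑ b ∈ range (r + 1), ((b : ℤ) - τ b) = 0 := by
  rw [sum_sub_distrib, sub_eq_zero]
  symm
  refine sum_equiv τ (fun b => ?_) fun _ _ => rfl
  simp only [mem_range, Nat.lt_succ_iff]
  refine ⟨apply_le hτ, fun h => ?_⟩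
  have := symm_le hτ h
  rwa [τ.symm_apply_apply] at this

lemma sum_shiftCoord_eq_zero {τ : Equiv.Perm ℕ} {r i j : ℕ} (hτ : ∀ b, r < b → τ b = b)
    (hij : i ≤ j) (hj : j < r) : ∑ b ∈ range (r + 1), shiftCoord r i j τ b = 0 := by
  rw [sum_shiftCoord, sum_sub_eq_zero hτ, if_pos (symm_le hτ (Nat.zero_le _)),
    if_pos (symm_le hτ le_rfl), if_pos (by omega), if_pos (by omega)]
  norm_num

/-- The highest root adds at most one to a coefficient and `μ` adds nothing positive, so the partial
sums of `b - τ b` are `-1` or 0. Consecutive ones differ by at most one. -/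
lemma isBand_of_nonneg {τ : Equiv.Perm ℕ} {r i j : ℕ} (hτ : ∀ b, r < b → τ b = b)
    (hij : i ≤ j) (h : ∀ k < r, 0 ≤ ∑ b ∈ range (k + 1), shiftCoord r i j τ b) : IsBand τ := by
  have hE : ∀ n ≤ r + 1, -1 ≤ ∑ b ∈ range n, ((b : ℤ) - τ b) := by
    intro n hn
    rcases n with _ | k
    · simp
    · rcases eq_or_lt_of_le hn with hk | hk
      · rw [hk, sum_sub_eq_zero hτ]
        norm_num
      · have h1 := h k (by omega)
        rw [sum_shiftCoord] at h1
        split_ifs at h1 <;> omega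
  intro b
  rcases lt_or_ge r b with hb | hb
  · rw [hτ b hb]
    omega
  · have h1 := hE b (by omega)
    have h2 := hE (b + 1) (by omega)
    have h3 := sum_sub_nonpos τ b
    have h4 := sum_sub_nonpos τ (b + 1)
    rw [sum_range_succ] at h2 h4
    omega

/-- Besides its own `-1`, a transposition at an end moves the coordinate `0` or `r` of the highest
root across the cut, which costs one more. -/
lemma IsBand.sum_shiftCoord {τ : Equiv.Perm ℕ} (h : IsBand τ) {r i j k : ℕ} (hij : i ≤ j)
    (hk : k < r) :
    ∑ b ∈ range (k + 1), shiftCoord r i j τ b = 1 - (if i ≤ k ∧ k ≤ j then 1 else 0) -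
      if τ k = k + 1 then 1 + (if k = 0 then 1 else 0) + (if k + 1 = r then 1 else 0) else 0 := by
  rw [TypeA.sum_shiftCoord, h.sum_sub]
  have h1 : τ.symm 0 ≤ k ↔ ¬ (τ k = k + 1 ∧ k = 0) := by
    have e := h.symm 0
    constructor
    · rintro h2 ⟨h3, rfl⟩
      have h4 : τ.symm 0 = 0 := by omega
      have := τ.symm_apply_eq.1 h4
      omega
    · intro h2
      by_contra h3
      have h4 : k = 0 := by omega
      have h5 : τ.symm 0 = 0 + 1 := by omega
      subst h4
      exact h2 ⟨h.apply_of_succ (τ.symm_apply_eq.1 h5).symm, rfl⟩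
  have h2 : τ.symm r ≤ k ↔ τ k = k + 1 ∧ k + 1 = r := by
    have e := h.symm r
    constructor
    · intro h2
      have h3 : τ.symm r = k := by omega
      have h4 := τ.symm_apply_eq.1 h3
      omega
    · rintro ⟨h3, h4⟩
      rw [τ.symm_apply_eq.2 (h4.symm.trans h3.symm)]
  simp only [h1, h2]
  split_ifs <;> omega

/-- No adjacent transposition in `τ` involves a boundary position or `i, …, j`. -/
def IsAdmissible (r i j : ℕ) (τ : Equiv.Perm ℕ) : Prop :=
  IsBand τ ∧ ∀ k, τ k = k + 1 → k ≠ 0 ∧ k + 1 ≠ r ∧ ¬ (i ≤ k ∧ k ≤ j)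

/-- The simple roots that occur in `σ⁻¹(α̃ + ρ) - ρ - (α_i + ⋯ + α_j)`. -/
def shiftSupport (r i j : ℕ) (τ : Equiv.Perm ℕ) : Finset ℕ :=
  {k ∈ range r | ¬ (i ≤ k ∧ k ≤ j) ∧ τ k ≠ k + 1}

lemma isAdmissible_of_nonneg {τ : Equiv.Perm ℕ} {r i j : ℕ} (hτ : ∀ b, r < b → τ b = b)
    (hij : i ≤ j) (h : ∀ k < r, 0 ≤ ∑ b ∈ range (k + 1), shiftCoord r i j τ b) :
    IsAdmissible r i j τ := by
  have hb := isBand_of_nonneg hτ hij h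
  refine ⟨hb, fun k hk => ?_⟩
  have hkr : k < r := by
    by_contra! hkr
    have := τ.injective (hk.trans (hτ (k + 1) (by omega)).symm)
    omega
  have h1 := h k hkr
  rw [hb.sum_shiftCoord hij hkr, if_pos hk] at h1
  split_ifs at h1 <;> omega

lemma IsAdmissible.sum_shiftCoord {τ : Equiv.Perm ℕ} {r i j : ℕ} (h : IsAdmissible r i j τ)
    (hij : i ≤ j) {k : ℕ} (hk : k < r) :
    ∑ b ∈ range (k + 1), shiftCoord r i j τ b = if k ∈ shiftSupport r i j τ then 1 else 0 := by
  rw [h.1.sum_shiftCoord hij hk]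
  have h1 := h.2 k
  simp only [shiftSupport, mem_filter, mem_range]
  split_ifs <;> omega

/-! ### The terms as products of tridiagonal entries -/

open Polynomial in
/-- The entries of a tridiagonal matrix whose determinant is the `q`-multiplicity. -/
def transferEntry (r i j a b : ℕ) : ℤ[X] :=
  if b = a then (if a = 0 ∨ i + 1 ≤ a ∧ a ≤ j + 1 then 1 else if a = i ∨ a = r then X else 1 + X)
  else if b = a + 1 then
    (if a = 0 ∨ a + 1 = r ∨ i ≤ a ∧ a ≤ j then 0 else if a = j + 1 then 1 else X)
  else if a = b + 1 then 1 else 0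

/-- Row `k + 1` carries the factor of the simple root `k`, and row 0 carries 1. The value `τ (k +
1)` decides it: going down means that `k` is transposed away (factor 1), going up means that `k + 1`
is missing from the support, and a fixed point leaves both to the position relative to `i`, `j` and
`r`. -/
lemma IsAdmissible.prod_transferEntry {τ : Equiv.Perm ℕ} {r i j : ℕ} (h : IsAdmissible r i j τ)
    (hij : i ≤ j) (hj : j < r) :
    ∏ a ∈ range (r + 1), transferEntry r i j a (τ a) = intervalPoly (shiftSupport r i j τ) := by
  have hS : shiftSupport r i j τ ⊆ range r := filter_subset _ _
  have h0 : τ 0 = 0 := by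
    have h1 := h.1 0
    have h2 := h.2 0
    omega
  have e : transferEntry r i j 0 (τ 0) = 1 := by simp [transferEntry, h0]
  rw [intervalPoly, prod_range_succ', e, mul_one,
    ← prod_subset hS (f := fun k => transferEntry r i j (k + 1) (τ (k + 1)))]
  · refine prod_congr rfl fun k hk => ?_
    have hk' := mem_filter.1 hk
    have h1 : τ (k + 1) ≠ k := fun e => hk'.2.2 (h.1.apply_of_succ e)
    have h2 := h.1 (k + 1)
    have h3 := h.2 (k + 1)
    have h4 := mem_range.1 hk'.1
    have h5 := hk'.2
    simp only [transferEntry, shiftSupport, mem_filter, mem_range, Nat.add_one_ne_zero, false_or]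
    split_ifs <;> first | rfl | omega
  · intro k hk hk'
    have h1 : τ (k + 1) = k ↔ τ k = k + 1 := ⟨h.1.apply_of_succ, h.1.apply_succ⟩
    have h2 := h.1 (k + 1)
    have h3 := h.2 (k + 1)
    have h4 := h.2 k
    simp only [shiftSupport, mem_filter, hk, true_and] at hk'
    rw [mem_range] at hk
    simp only [transferEntry, Nat.add_one_ne_zero, false_or]
    split_ifs <;> first | rfl | omega

lemma prod_transferEntry_eq_zero {τ : Equiv.Perm ℕ} {r i j : ℕ}
    (hτ : ∀ b, r < b → τ b = b) (h : ¬ IsAdmissible r i j τ) :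
    ∏ a ∈ range (r + 1), transferEntry r i j a (τ a) = 0 := by
  have hx : ∃ a, transferEntry r i j a (τ a) = 0 := by
    by_contra! hne
    refine h ⟨fun b => ?_, fun k hk => ?_⟩
    · have h1 := hne b
      simp only [transferEntry] at h1
      split_ifs at h1 <;> first | omega | exact absurd rfl h1
    · by_contra h2
      apply hne k
      simp only [transferEntry, hk]
      rw [if_neg (by omega), if_pos trivial, if_pos (by omega)]
  obtain ⟨a, ha⟩ := hx
  -- Beyond `r` only diagonal entries occur; these are 1, `X` or `1 + X`, so the vanishing entry has
  -- index at most `r`.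
  refine prod_eq_zero (i := a) (mem_range.2 ?_) ha
  by_contra! har
  rw [hτ a har, transferEntry, if_pos rfl] at ha
  split_ifs at ha
  · exact one_ne_zero ha
  · exact Polynomial.X_ne_zero ha
  · have := congrArg (Polynomial.eval 0) ha
    simp at this

/-- The term of the `q`-multiplicity for one permutation. -/
lemma qPartition_shift (r : ℕ) (i j : Fin r) (hij : i ≤ j) (σ : Equiv.Perm (Fin (r + 1))) :
    qPartition r (permAction r σ⁻¹ (highestRoot r + rho r) - rho r - rootSum r i j) =
      ∏ a : Fin (r + 1), transferEntry r i j a (σ a) := by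
  have hτ : ∀ b, r < b → natPerm σ b = b := fun b hb => natPerm_of_lt σ hb
  have hij' : (i : ℕ) ≤ j := hij
  have hx := sum_shiftCoord_eq_zero hτ hij' j.2
  have hprod : ∏ a : Fin (r + 1), transferEntry r i j a (σ a) =
      ∏ a ∈ range (r + 1), transferEntry r i j a (natPerm σ a) := by
    rw [← Fin.prod_univ_eq_prod_range (fun a => transferEntry r i j a (natPerm σ a))]
    simp only [natPerm_val]
  rw [weight_eq_sum_shiftCoord r i j hij, hprod]
  by_cases h : ∀ k < r, 0 ≤ ∑ b ∈ range (k + 1), shiftCoord r i j (natPerm σ) b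
  · have ha := isAdmissible_of_nonneg hτ hij' h
    rw [ha.prod_transferEntry hij' j.2,
      sum_eq_simpleSum _ hx _ (filter_subset _ _) fun k hk => ha.sum_shiftCoord hij' hk,
      qPartition_simpleSum (filter_subset _ _)]
    rfl
  · have hna : ¬ IsAdmissible r i j (natPerm σ) := by
      intro ha
      apply h
      intro k hk
      rw [ha.sum_shiftCoord hij' hk]
      split_ifs <;> norm_num
    push Not at h
    obtain ⟨k, hk, hneg⟩ := h
    rw [prod_transferEntry_eq_zero hτ hna]
    apply qPartition_eq_zero (k := k)
    rw [coeffAt_sum _ hx hk]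
    exact_mod_cast hneg

/-! ### Triangular factorization and determinant -/

lemma sum_unipotent_left {R : Type*} [Semiring R] {n a : ℕ} (ha : a < n) {p : Prop} [Decidable p]
    (hp : p → a + 1 < n) (f : ℕ → R) :
    ∑ c ∈ range n, (if a = c then 1 else if c = a + 1 ∧ p then 1 else 0) * f c =
      f a + if p then f (a + 1) else 0 := by
  have h : ∀ c, (if a = c then (1 : R) else if c = a + 1 ∧ p then 1 else 0) * f c =
      (if a = c then f c else 0) + (if a + 1 = c then (if p then f c else 0) else 0) := by
    intro c
    by_cases hp' : p
    · simp only [hp', and_true, if_true]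
      split_ifs <;> first | omega | simp
    · simp only [hp', and_false, if_false]
      split_ifs <;> first | omega | simp
  simp only [h]
  rw [sum_add_distrib, sum_ite_eq, sum_ite_eq, if_pos (mem_range.2 ha)]
  by_cases h : p
  · rw [if_pos (mem_range.2 (hp h))]
  · simp [h]

lemma sum_unipotent_right {R : Type*} [Semiring R] {n b : ℕ} (hb : b < n) {p : Prop} [Decidable p]
    (hp : p → 1 ≤ b) (f : ℕ → R) :
    ∑ c ∈ range n, f c * (if c = b then 1 else if b = c + 1 ∧ p then 1 else 0) =
      f b + if p then f (b - 1) else 0 := by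
  have h : ∀ c, f c * (if c = b then (1 : R) else if b = c + 1 ∧ p then 1 else 0) =
      (if b = c then f c else 0) + (if b - 1 = c then (if p then f c else 0) else 0) := by
    intro c
    by_cases hp' : p
    · have := hp hp'
      simp only [hp', and_true, if_true]
      split_ifs <;> first | omega | simp
    · simp only [hp', and_false, if_false]
      split_ifs <;> first | omega | simp
  simp only [h]
  rw [sum_add_distrib, sum_ite_eq, sum_ite_eq, if_pos (mem_range.2 hb),
    if_pos (mem_range.2 (by omega))]

open Polynomial

/-- The entries of the lower bidiagonal factor of `transferEntry`. -/
def lowerEntry (i j a b : ℕ) : ℤ[X] :=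
  if a = b then (if a = 0 ∨ i + 1 ≤ a ∧ a ≤ j + 1 then 1 else X)
  else if a = b + 1 then 1 else 0

/-- To the left of the support of `μ`, adding row `a + 1` to row `a` of the bidiagonal matrix turns
a diagonal `X` into `1 + X` and creates the entry above the diagonal. To the right, adding column `b
- 1` to column `b` does the same. The cases run through the diagonals from below. -/
lemma transferEntry_eq {r i j a b : ℕ} (hij : i ≤ j) (hj : j < r) (ha : a ≤ r) (hb : b ≤ r) :
    transferEntry r i j a b =
      (lowerEntry i j a b + if 1 ≤ a ∧ a < i then lowerEntry i j (a + 1) b else 0) +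
        if j + 2 ≤ b ∧ b < r then
          lowerEntry i j a (b - 1) + if 1 ≤ a ∧ a < i then lowerEntry i j (a + 1) (b - 1) else 0
        else 0 := by
  have hzero : ∀ c d : ℕ, c ≠ d → c ≠ d + 1 → lowerEntry i j c d = 0 := fun c d h1 h2 => by
    rw [lowerEntry, if_neg h1, if_neg h2]
  have hone : ∀ c d : ℕ, c = d + 1 → lowerEntry i j c d = 1 := fun c d h => by
    rw [lowerEntry, if_neg (by omega), if_pos h]
  rcases lt_or_ge (b + 1) a with h | h
  · rw [hzero a b (by omega) (by omega), hzero (a + 1) b (by omega) (by omega),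
      hzero a (b - 1) (by omega) (by omega), hzero (a + 1) (b - 1) (by omega) (by omega),
      transferEntry, if_neg (by omega), if_neg (by omega), if_neg (by omega)]
    simp only [ite_self, add_zero]
  rcases eq_or_lt_of_le h with rfl | h
  · rw [hone (b + 1) b rfl, hzero (b + 1 + 1) b (by omega) (by omega),
      transferEntry, if_neg (by omega), if_neg (by omega), if_pos rfl, ite_self, add_zero]
    split_ifs
    · rw [hzero _ _ (by omega) (by omega), hzero _ _ (by omega) (by omega), add_zero, add_zero]
    · rw [hzero _ _ (by omega) (by omega), add_zero, add_zero]
    · rw [add_zero]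
  rcases eq_or_lt_of_le (Nat.lt_succ_iff.1 h) with rfl | h
  · rw [hone (a + 1) a rfl, transferEntry, if_pos rfl, lowerEntry, if_pos rfl]
    by_cases h1 : j + 2 ≤ a ∧ a < r
    · rw [if_pos h1, hone a (a - 1) (by omega), if_neg (by omega), if_neg (by omega),
        if_neg (by omega), if_neg (by omega), add_zero, if_neg (by omega), add_zero, add_comm]
    · rw [if_neg h1, add_zero]
      by_cases h2 : 1 ≤ a ∧ a < i
      · rw [if_pos h2, if_neg (by omega), if_neg (by omega), if_neg (by omega), add_comm]
      · rw [if_neg h2, add_zero]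
        split_ifs <;> first | omega | rfl
  rcases eq_or_lt_of_le (Nat.succ_le_of_lt h) with rfl | h
  · rw [hzero a _ (by omega) (by omega), transferEntry, if_neg (by omega), if_pos rfl, zero_add,
      Nat.succ_eq_add_one, Nat.add_sub_cancel, hone (a + 1) a rfl, lowerEntry, if_pos rfl,
      lowerEntry, if_pos rfl]
    by_cases h1 : j + 2 ≤ a + 1 ∧ a + 1 < r
    · have h2 : ¬ (1 ≤ a ∧ a < i) := by omega
      rw [if_pos h1, if_neg (by omega), if_neg h2, if_neg h2, add_zero, zero_add]
      split_ifs <;> first | omega | rfl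
    · rw [if_neg h1, add_zero]
      simp only [Nat.add_one_ne_zero, false_or]
      split_ifs <;> first | omega | rfl
  · rw [hzero a b (by omega) (by omega), hzero (a + 1) b (by omega) (by omega),
      hzero a (b - 1) (by omega) (by omega),
      transferEntry, if_neg (by omega), if_neg (by omega), if_neg (by omega), ite_self]
    split_ifs
    · rw [hzero _ _ (by omega) (by omega), add_zero, add_zero]
    · rw [add_zero, add_zero]
    · rw [add_zero, add_zero]

/-- The tridiagonal matrix whose determinant is the `q`-multiplicity. -/
def transferMatrix (r i j : ℕ) : Matrix (Fin (r + 1)) (Fin (r + 1)) ℤ[X] :=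
  Matrix.of fun a b => transferEntry r i j a b

lemma transferMatrix_eq {r i j : ℕ} (hij : i ≤ j) (hj : j < r) :
    transferMatrix r i j =
      (Matrix.of fun a c : Fin (r + 1) => if (a : ℕ) = c then 1 else
        if (c : ℕ) = a + 1 ∧ (1 ≤ (a : ℕ) ∧ (a : ℕ) < i) then 1 else 0) *
      (Matrix.of fun a b : Fin (r + 1) => lowerEntry i j a b) *
      (Matrix.of fun c b : Fin (r + 1) => if (c : ℕ) = b then 1 else
        if (b : ℕ) = c + 1 ∧ (j + 2 ≤ (b : ℕ) ∧ (b : ℕ) < r) then 1 else 0) := by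
  have h1 : (Matrix.of fun a c : Fin (r + 1) => if (a : ℕ) = c then 1 else
        if (c : ℕ) = a + 1 ∧ (1 ≤ (a : ℕ) ∧ (a : ℕ) < i) then 1 else 0) *
      (Matrix.of fun a b : Fin (r + 1) => lowerEntry i j a b) =
      Matrix.of fun a b : Fin (r + 1) =>
        lowerEntry i j a b + if 1 ≤ (a : ℕ) ∧ (a : ℕ) < i then lowerEntry i j (a + 1) b else 0 := by
    ext1 a b
    rw [Matrix.mul_apply]
    simp only [Matrix.of_apply]
    rw [Fin.sum_univ_eq_sum_range (fun c => (if (a : ℕ) = c then (1 : ℤ[X]) else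
        if c = a + 1 ∧ (1 ≤ (a : ℕ) ∧ (a : ℕ) < i) then 1 else 0) * lowerEntry i j c b),
      sum_unipotent_left a.2 (by omega)]
  rw [h1]
  ext1 a b
  rw [Matrix.mul_apply]
  simp only [Matrix.of_apply]
  rw [Fin.sum_univ_eq_sum_range (fun c => (lowerEntry i j a c +
      if 1 ≤ (a : ℕ) ∧ (a : ℕ) < i then lowerEntry i j (a + 1) c else 0) *
        if c = (b : ℕ) then (1 : ℤ[X]) else
        if (b : ℕ) = c + 1 ∧ (j + 2 ≤ (b : ℕ) ∧ (b : ℕ) < r) then 1 else 0),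
    sum_unipotent_right b.2 (by omega)]
  exact transferEntry_eq hij hj (by omega) (by omega)

/-- Only the diagonal of the lower factor matters: it is 1 in row 0 and in the rows `i + 1, …, j +
1`, and `X` in the others. -/
lemma det_transferMatrix {r i j : ℕ} (hij : i ≤ j) (hj : j < r) :
    (transferMatrix r i j).det = X ^ (r - (j - i + 1)) := by
  rw [transferMatrix_eq hij hj, Matrix.det_mul, Matrix.det_mul,
    Matrix.det_of_isUpperTriangular, Matrix.det_of_isLowerTriangular,
    Matrix.det_of_isUpperTriangular]
  · simp only [Matrix.of_apply, if_true, prod_const_one, one_mul, mul_one, lowerEntry]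
    rw [Fin.prod_univ_eq_prod_range
      (fun a => if a = 0 ∨ i + 1 ≤ a ∧ a ≤ j + 1 then (1 : ℤ[X]) else X), prod_range_succ',
      if_pos (Or.inl rfl), mul_one, prod_ite, prod_const_one, one_mul, prod_const]
    congr 1
    have e : (range r).filter (fun a => ¬ (a + 1 = 0 ∨ i + 1 ≤ a + 1 ∧ a + 1 ≤ j + 1)) =
        range r \ Icc i j := by
      ext a
      simp only [mem_filter, mem_sdiff, mem_Icc, mem_range]
      omega
    rw [e, card_sdiff_of_subset, card_range, Nat.card_Icc]
    · omega
    · intro a ha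
      rw [mem_Icc] at ha
      rw [mem_range]
      omega
  · intro a b hab
    have h : (b : ℕ) < a := hab
    simp only [Matrix.of_apply]
    rw [if_neg (by omega), if_neg (by omega)]
  · intro a b hab
    have h : (a : ℕ) < b := hab
    simp only [Matrix.of_apply, lowerEntry]
    rw [if_neg (by omega), if_neg (by omega)]
  · intro a b hab
    have h : (b : ℕ) < a := hab
    simp only [Matrix.of_apply]
    rw [if_neg (by omega), if_neg (by omega)]

theorem qMultiplicity_highestRoot (r : ℕ) (i j : Fin r) (hij : i ≤ j) :
    qMultiplicity r (highestRoot r) (rootSum r i j) = X ^ (r - ((j : ℕ) - (i : ℕ) + 1)) := by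
  have hij' : (i : ℕ) ≤ j := hij
  -- `Matrix.det_apply` takes entries at `(σ a, a)`, whereas the terms here use `(a, σ a)`; hence
  -- the transpose.
  rw [qMultiplicity_eq_sum_perm, ← det_transferMatrix hij' j.2, ← Matrix.det_transpose,
    Matrix.det_apply]
  refine sum_congr rfl fun σ _ => ?_
  rw [qPartition_shift r i j hij, Units.smul_def]
  rfl

/-! ### The weight space in the adjoint representation -/

lemma diagEntry_sub_eq_rootSum {r : ℕ} {i j : Fin r} (hij : i ≤ j) {a b : Fin (r + 1)}
    (h : diagEntry r a - diagEntry r b = rootSum r i j) : a = i.castSucc ∧ b = j.succ := by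
  have hij' : (i : ℕ) ≤ j := hij
  have hc : ∀ k : ℕ, ((i : ℕ) ≤ k ∧ k ≤ j) ↔ ((a : ℕ) ≤ k ∧ ¬ (b : ℕ) ≤ k) := by
    intro k
    have h1 := congrArg (coeffAt r k) h
    rw [coeffAt_rootSum r k hij, coeffAt_diagEntry_sub] at h1
    split_ifs at h1 with h2 h3 h4 h4 h3 h4 h4 <;> first | (exfalso; norm_num at h1; done) | tauto
  have h1 := hc i
  have h2 := hc j
  have h3 := hc a
  have h4 := hc (b - 1)
  have h5 := hc b
  constructor <;> apply Fin.ext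
  · simp only [Fin.val_castSucc]; omega
  · simp only [Fin.val_succ]; omega

lemma lie_apply (r : ℕ) (H : cartan r) (X : SL r) (a b : Fin (r + 1)) :
    (⁅H, X⁆ : SL r).1 a b = (H.1.1 a a - H.1.1 b b) * X.1 a b := by
  have hd : H.1.1 = Matrix.diagonal H.1.1.diag := (Matrix.IsDiag.diagonal_diag H.2).symm
  have e : (⁅H, X⁆ : SL r).1 = H.1.1 * X.1 - X.1 * H.1.1 := rfl
  rw [e, hd, Matrix.sub_apply, Matrix.diagonal_mul, Matrix.mul_diagonal]
  simp only [Matrix.diag_apply, Matrix.diagonal_apply_eq]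
  ring

lemma finrank_adjointWeightSpace (r : ℕ) (i j : Fin r) (hij : i ≤ j) :
    finrank ℂ (adjointWeightSpace r (rootSum r i j)) = 1 := by
  have hne : i.castSucc ≠ j.succ := (Fin.castSucc_lt_succ_iff.2 hij).ne
  have hmem : LieAlgebra.SpecialLinear.single _ _ hne (1 : ℂ) ∈
      adjointWeightSpace r (rootSum r i j) := by
    rw [adjointWeightSpace, LieModule.mem_weightSpace]
    intro H
    ext a b
    change _ = rootSum r i j H * (LieAlgebra.SpecialLinear.single _ _ hne (1 : ℂ)).1 a b
    rw [lie_apply]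
    simp only [rootSum_eq r i j hij, LinearMap.sub_apply, diagEntry_apply,
      LieAlgebra.SpecialLinear.val_single, Matrix.single_apply]
    split_ifs with hab
    · rw [← hab.1, ← hab.2]
    · simp
  refine finrank_eq_one (⟨_, hmem⟩ : adjointWeightSpace r (rootSum r i j)) ?_ ?_
  · intro h0
    have h1 := congrArg (fun X : adjointWeightSpace r (rootSum r i j) =>
      X.1.1 i.castSucc j.succ) h0
    simp at h1
  · rintro ⟨X, hX⟩
    refine ⟨X.1 i.castSucc j.succ, Subtype.ext (Subtype.ext (Matrix.ext fun a b => ?_))⟩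
    change X.1 i.castSucc j.succ * (LieAlgebra.SpecialLinear.single _ _ hne (1 : ℂ)).1 a b = X.1 a b
    rw [LieAlgebra.SpecialLinear.val_single, Matrix.single_apply]
    split_ifs with hab
    · rw [mul_one, hab.1, hab.2]
    · rw [mul_zero]
      by_contra h0
      have h0 : X.1 a b ≠ 0 := Ne.symm h0
      rw [adjointWeightSpace, LieModule.mem_weightSpace] at hX
      -- A nonzero entry at `(a, b)` forces the weight to be the difference of these two
      -- coordinates, which determines the position.
      have h1 : diagEntry r a - diagEntry r b = rootSum r i j := by
        ext H
        have h2 : (⁅H, X⁆ : SL r).1 a b = rootSum r i j H * X.1 a b :=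
          congrArg (fun X : SL r => X.1 a b) (hX H)
        rw [lie_apply] at h2
        exact mul_right_cancel₀ h0 h2
      obtain ⟨rfl, rfl⟩ := diagEntry_sub_eq_rootSum hij h1
      exact hab ⟨rfl, rfl⟩

end
end TypeA

/-- For `μ = α_i + ⋯ + α_j` the `q`-multiplicity of `μ` in the adjoint representation is
`q^{r - h(μ)}` with `h(μ) = j - i + 1`; its value at `q = 1` is the multiplicity of the weight `μ`
in the adjoint representation, which is one. -/
theorem theorem4p1 (r : ℕ) (i j : Fin r) (hij : i ≤ j) :
    TypeA.qMultiplicity r (TypeA.highestRoot r) (TypeA.rootSum r i j) =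
        (Polynomial.X : Polynomial ℤ) ^ (r - ((j : ℕ) - (i : ℕ) + 1)) ∧
      (TypeA.qMultiplicity r (TypeA.highestRoot r) (TypeA.rootSum r i j)).eval 1 =
        (Module.finrank ℂ (TypeA.adjointWeightSpace r (TypeA.rootSum r i j)) : ℤ) ∧
      Module.finrank ℂ (TypeA.adjointWeightSpace r (TypeA.rootSum r i j)) = 1 := by
  rw [TypeA.finrank_adjointWeightSpace r i j hij, TypeA.qMultiplicity_highestRoot r i j hij]
  simp
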